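/- Let $p$ be an odd prime and let $L/K$ be an extension of degree $p$ of $p$-adic fields (finite extensions of $\mathbb{Q}_p$), with normal closure $\widetilde L$. For a $p$-adic field $F$ let $\mathcal{O}_F$ be its ring of integers and $\mathfrak{p}_F$ its maximal ideal. Let $H$ be the Hopf–Galois structure on $L/K$, that is, $H$ is a finite-dimensional cocommutative $K$-Hopf algebra acting on $L$ such that $L$ is an $H$-module algebra and the map $L\otimes_K H\to\mathrm{End}_K(L)$, $x\otimes h\mapsto (y\mapsto x(h\cdot y))$, is bijective (such a structure is known to exist and to be unique up to isomorphism; the assertions below hold for every such $H$). Let $$\mathfrak{A}_{L/K}=\{h\in H \mid h\cdot\mathcal{O}_L\subseteq\mathcal{O}_L\}$$ be the associated order of $\mathcal{O}_L$ in $H$. Let $G=\mathrm{Gal}(\widetilde L/K)$ with lower ramification groups $G_i=\{\sigma\in G \mid \sigma x\equiv x \bmod \mathfrak{p}_{\widetilde L}^{\,i+1}\ \text{for all } x\in\mathcal{O}_{\widetilde L}\}$, let $t$ be the ramification jump of $\widetilde L/K$ (the integer $t\ge -1$ with $|G_t|=p$ and $G_{t+1}=1$), let $r=[\widetilde L:L']$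 where $L'$ is the inertia field of $\widetilde L/L$, let $c$ be the remainder of $t$ modulo $r$, and let $a$ be the remainder modulo $p$ of the integer $\ell=\frac{pc(r-1)+t}{r}$. Assume that we are in the maximally ramified case, that is, $a=0$, or $L=K(\alpha)$ for some $\alpha$ such that $\alpha^p$ is a uniformizer of $K$. Then: 1. There is $\alpha\in L$ such that $L=K(\alpha)$ and $\alpha^p$ is a uniformizer of $K$. 2. For every such $\alpha$, $\mathfrak{A}_{L/K}$ has an $\mathcal{O}_K$-basis $v_0,\dots,v_{p-1}$ with $v_iv_j=\delta_{ij}v_i$ and $v_i\cdot\alpha^j=\delta_{ij}\alpha^j$ for all $0\le i,j\le p-1$. 3. $\mathfrak{A}_{L/K}$ is the maximal $\mathcal{O}_K$-order in $H$: it is an $\mathcal{O}_K$-order (an $\mathcal{O}_K$-subalgebra that is finitely generated as an $\mathcal{O}_K$-module and spans $H$ over $K$) and it contains every $\mathcal{O}_K$-order in $H$. 4. $\mathcal{O}_L$ is a free $\mathfrak{A}_{L/K}$-module. -/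

import Mathlib

noncomputable section

open scoped TensorProduct

namespace HopfGaloisPadic

/-! ### Rings of integers of `p`-adic fields and ramification groups -/

section Integers

variable (p : ℕ) [Fact p.Prime]

/-- The ring of integers `𝓞_F` of a `p`-adic field `F`: the integral closure of `ℤ_[p]` in `F`,
viewed as a subring of `F`. -/
def ringOfIntegers (F : Type*) [Field F] [Algebra ℚ_[p] F] : Subring F :=
  letI : Algebra ℤ_[p] F := Algebra.compHom F (algebraMap ℤ_[p] ℚ_[p])
  (integralClosure ℤ_[p] F).toSubring

theorem mem_ringOfIntegers {F : Type*} [Field F] [Algebra ℚ_[p] F] {x : F} :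
    x ∈ ringOfIntegers p F ↔
      ((algebraMap ℚ_[p] F).comp (algebraMap ℤ_[p] ℚ_[p])).IsIntegralElem x :=
  Iff.rfl

theorem map_mem_ringOfIntegers {E F : Type*} [Field E] [Algebra ℚ_[p] E] [Field F]
    [Algebra ℚ_[p] F] (f : E →ₐ[ℚ_[p]] F) {x : E} (hx : x ∈ ringOfIntegers p E) :
    f x ∈ ringOfIntegers p F := by
  rw [mem_ringOfIntegers] at hx ⊢
  obtain ⟨q, hq, hx⟩ := hx
  refine ⟨q, hq, ?_⟩
  have h : (algebraMap ℚ_[p] F).comp (algebraMap ℤ_[p] ℚ_[p]) =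
      (f : E →+* F).comp ((algebraMap ℚ_[p] E).comp (algebraMap ℤ_[p] ℚ_[p])) := by
    ext z
    simp
  have h2 := Polynomial.hom_eval₂ q
    ((algebraMap ℚ_[p] E).comp (algebraMap ℤ_[p] ℚ_[p])) (f : E →+* F) x
  rw [hx, map_zero] at h2
  rw [h]
  exact h2.symm

theorem smul_mem_ringOfIntegers {K L : Type*} [Field K] [Algebra ℚ_[p] K] [Field L]
    [Algebra ℚ_[p] L] [Algebra K L] [IsScalarTower ℚ_[p] K L] (c : ringOfIntegers p K)
    {x : L} (hx : x ∈ ringOfIntegers p L) : (c : K) • x ∈ ringOfIntegers p L := by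
  rw [Algebra.smul_def]
  exact mul_mem (map_mem_ringOfIntegers p (IsScalarTower.toAlgHom ℚ_[p] K L) c.2) hx

variable (K E : Type*) [Field K] [Algebra ℚ_[p] K] [Field E] [Algebra ℚ_[p] E] [Algebra K E]
  [IsScalarTower ℚ_[p] K E]

/-- The natural action of `Gal(E/K)` on `𝓞_E`. -/
instance galActionRingOfIntegers : MulSemiringAction (E ≃ₐ[K] E) (ringOfIntegers p E) where
  smul σ x := ⟨σ x, map_mem_ringOfIntegers p ((σ : E →ₐ[K] E).restrictScalars ℚ_[p]) x.2⟩
  one_smul _ := rfl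
  mul_smul _ _ _ := rfl
  smul_zero σ := Subtype.ext (map_zero σ)
  smul_add σ x y := Subtype.ext (map_add σ (x : E) (y : E))
  smul_one σ := Subtype.ext (map_one σ)
  smul_mul σ x y := Subtype.ext (map_mul σ (x : E) (y : E))

/-- The maximal ideal `𝔭_E` of `𝓞_E`. The ring `𝓞_E` is local, so its maximal ideal is its
Jacobson radical. -/
def primeIdeal (E : Type*) [Field E] [Algebra ℚ_[p] E] : Ideal (ringOfIntegers p E) :=
  Ideal.jacobson ⊥

/-- The `i`-th ramification group (lower numbering)
`G_i = {σ ∈ Gal(E/K) | σ x ≡ x mod 𝔭_E ^ (i + 1) for all x ∈ 𝓞_E}`, for `i ≥ -1`. -/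
def ramificationGroup (i : ℤ) : Subgroup (E ≃ₐ[K] E) :=
  (primeIdeal p E ^ (i + 1).toNat).inertia (E ≃ₐ[K] E)

/-- `t` is the ramification jump of `E/K`: `G_t` has order `p` and `G_{t+1}` is trivial. -/
def IsRamificationJump (t : ℤ) : Prop :=
  Nat.card (ramificationGroup p K E t) = p ∧ ramificationGroup p K E (t + 1) = ⊥

/-- The inertia field of `E/K`. -/
def inertiaField : IntermediateField K E :=
  IntermediateField.fixedField (ramificationGroup p K E 0)

end Integers

/-! ### The maximally ramified case -/

section MaximallyRamified

variable (p : ℕ) [Fact p.Prime]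

/-- The condition `a = 0` for `L/K` with normal closure `E`: here `t` is the ramification jump of
`E/K`, `r = [E : L']` with `L'` the inertia field of `E/L`, `c` is the remainder of `t` mod `r`,
`ℓ = (p c (r - 1) + t) / r` and `a` is the remainder of `ℓ` mod `p`. -/
def IsMaximallyRamified (K L E : Type*) [Field K] [Algebra ℚ_[p] K] [Field L] [Algebra ℚ_[p] L]
    [Algebra K L] [Field E] [Algebra ℚ_[p] E] [Algebra K E] [Algebra L E]
    [IsScalarTower ℚ_[p] K E] [IsScalarTower ℚ_[p] L E] : Prop :=
  ∃ t r c ℓ : ℤ, IsRamificationJump p K E t ∧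
    r = (Module.finrank (inertiaField p L E) E : ℤ) ∧
    c = t % r ∧
    r * ℓ = p * c * (r - 1) + t ∧
    ℓ % p = 0

/-- `α` is a `p`-th root of a uniformizer of `K` and `L = K(α)`. -/
def IsGeneratingRoot (K : Type*) {L : Type*} [Field K] [Algebra ℚ_[p] K] [Field L] [Algebra K L]
    (α : L) : Prop :=
  (∃ ϖ : ringOfIntegers p K, Irreducible ϖ ∧ α ^ p = algebraMap K L ϖ) ∧
    IntermediateField.adjoin K {α} = ⊤

end MaximallyRamified

/-! ### Hopf-Galois structures -/

section HopfGalois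

variable (K H L : Type*) [Field K] [Field L] [Algebra K L] [Ring H] [HopfAlgebra K H]
  [Module H L] [IsScalarTower K H L]

/-- The `K`-linear map `h ↦ (y ↦ h • y)`. -/
def actionMap : H →ₗ[K] Module.End K L where
  toFun h :=
    { toFun := fun y => h • y
      map_add' := smul_add h
      map_smul' := fun k y => by
        have := (IsScalarTower.to_smulCommClass' (R := K) (A := H) (M := L)).smul_comm h k y
        simpa using this }
  map_add' h h' := LinearMap.ext fun y => add_smul h h' y
  map_smul' k h := LinearMap.ext fun y => smul_assoc k h y

/-- The map `j : L ⊗ H → End_K(L)`, `x ⊗ h ↦ (y ↦ x (h • y))`. -/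
def jMap : L ⊗[K] H →ₗ[K] Module.End K L :=
  TensorProduct.lift
    ((LinearMap.mul K (Module.End K L)).compl₁₂ (LinearMap.mul K L) (actionMap K H L))

theorem jMap_tmul_apply (x : L) (h : H) (y : L) : jMap K H L (x ⊗ₜ h) y = x * (h • y) :=
  rfl

/-- The `K`-Hopf algebra `H` with its action on `L` is a Hopf-Galois structure on `L/K`: `H` is
finite-dimensional and cocommutative, `L` is an `H`-module algebra, and `j` is bijective. -/
structure IsHopfGalois : Prop where
  finite : Module.Finite K H
  cocomm : Coalgebra.IsCocomm K H
  /-- `h • (x y) = ∑ (h₁ • x) (h₂ • y)`, where `Δ h = ∑ h₁ ⊗ h₂`. -/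
  smul_mul : ∀ (h : H) (x y : L), h • (x * y) =
    LinearMap.mul' K L
      (TensorProduct.map ((actionMap K H L).flip x) ((actionMap K H L).flip y)
        (Coalgebra.comul (R := K) h))
  smul_one : ∀ h : H, h • (1 : L) = algebraMap K L (Coalgebra.counit (R := K) h)
  bijective : Function.Bijective (jMap K H L)

end HopfGalois

/-! ### Orders and the associated order -/

section Orders

variable (p : ℕ) [Fact p.Prime]

/-- `Λ` is an `𝓞_K`-order in the finite-dimensional `K`-algebra `A`: a subring containing the
image of `𝓞_K` which is finitely generated as an `𝓞_K`-module and spans `A` over `K`. -/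
def IsOrder (K : Type*) {A : Type*} [Field K] [Algebra ℚ_[p] K] [Ring A] [Algebra K A]
    (Λ : Subalgebra (ringOfIntegers p K) A) : Prop :=
  (Subalgebra.toSubmodule Λ).FG ∧ Submodule.span K (Λ : Set A) = ⊤

/-- `Λ` is the maximal `𝓞_K`-order in `A`: it is an order and contains every order. -/
def IsTheMaximalOrder (K : Type*) {A : Type*} [Field K] [Algebra ℚ_[p] K] [Ring A] [Algebra K A]
    (Λ : Subalgebra (ringOfIntegers p K) A) : Prop :=
  IsGreatest {Γ : Subalgebra (ringOfIntegers p K) A | IsOrder p K Γ} Λ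

variable (K H L : Type*) [Field K] [Algebra ℚ_[p] K] [Field L] [Algebra ℚ_[p] L] [Algebra K L]
  [IsScalarTower ℚ_[p] K L] [Ring H] [HopfAlgebra K H] [Module H L] [IsScalarTower K H L]

/-- The associated order `𝔄_H = {h ∈ H | h • 𝓞_L ⊆ 𝓞_L}`. -/
def associatedOrder : Subalgebra (ringOfIntegers p K) H where
  carrier := {h | ∀ x ∈ ringOfIntegers p L, h • x ∈ ringOfIntegers p L}
  mul_mem' {a b} ha hb x hx := by
    rw [mul_smul]
    exact ha _ (hb x hx)
  add_mem' {a b} ha hb x hx := by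
    rw [add_smul]
    exact add_mem (ha x hx) (hb x hx)
  algebraMap_mem' c x hx := by
    have h : algebraMap (ringOfIntegers p K) H c • x = (c : K) • x :=
      algebraMap_smul H (c : K) x
    rw [h]
    exact smul_mem_ringOfIntegers p c hx

/-- The action of `H` on `L` makes `𝓞_L` an `𝔄_H`-module. -/
instance moduleRingOfIntegers : Module (associatedOrder p K H L) (ringOfIntegers p L) where
  smul h x := ⟨(h : H) • (x : L), h.2 x x.2⟩
  one_smul x := Subtype.ext (one_smul H (x : L))
  mul_smul a b x := Subtype.ext (mul_smul (a : H) (b : H) (x : L))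
  smul_zero a := Subtype.ext (smul_zero (a : H))
  smul_add a x y := Subtype.ext (smul_add (a : H) (x : L) (y : L))
  add_smul a b x := Subtype.ext (add_smul (a : H) (b : H) (x : L))
  zero_smul x := Subtype.ext (zero_smul H (x : L))

end Orders

end HopfGaloisPadic

end

/-! Suppose first that `a = 0`. The relation `r ℓ = p c (r - 1) + t` gives `p ∣ t`. A `σ` of order
`p` in `G_t` changes `x`, relatively, by exactly order `t` whenever the order of `x` is prime to
`p`. Elements of `K` are fixed, so their orders in `E` are multiples of `p`; as `p ∤ [E : L]`, the
extension `L/K` is totally ramified. Expand `π ^ p = ∑ c_i π ^ i` for a uniformizer `π` of `L` and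
subtract this from its image under `σ`. The terms on the right have distinct valuations, and a
congruence modulo `p`, which needs `p ∣ t`, makes every `c_i π ^ i` with `i ≠ 0` small: `π ^ p = a
(1 + y)` with `a ∈ K` and `v y ≤ v p * v π` (`exists_pow_prime_eq_mul_one_add`). Multiplying `π` by
`1 - y / p` improves the error (`exists_better_root`). Once `1 + y` is a `p`-th power in `L`,
dividing by its root gives `α`.

Now let `α ^ p` be a uniformizer of `K`. Some `σ` of order `p` satisfies `σ α = ζ α` with `ζ` a
primitive `p`-th root of unity. Over `E` the embeddings `σ ^ j` of `L` are given by elements of `E ⊗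
H` that act as characters of the dual of `H`. There are at most `p` characters, `σ` permutes them
with order dividing `p`, and it fixes evaluation at `1`; hence it fixes all of them. It follows that
`σ (h • α ^ k) = ζ ^ k (h • α ^ k)` (`map_smul_pow_eq_of_pow_prime_eq_one`), so `h • α ^ k / α ^ k`
lies in `K`. Thus `H` acts diagonally on the powers of `α`, and comparing dimensions `H ≅ K ^ p`. As
these powers are an integral basis of `L`, the associated order is `𝓞_K ^ p`, which is maximal, and
`∑ α ^ k` generates `𝓞_L` freely over it. -/

noncomputable section

open scoped TensorProduct NNReal

namespace HopfGaloisPadic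

/-! ### The valuation of a `p`-adic field: integers, discreteness, residue field, `p`-th roots near
`1` -/

section PadicValuation

variable (p : ℕ) [Fact p.Prime]

/-- The absolute value of an algebraic extension of `ℚ_[p]` extending the one of `ℚ_[p]`. -/
def padicVal (F : Type*) [Field F] [Algebra ℚ_[p] F] [Algebra.IsAlgebraic ℚ_[p] F] :
    Valuation F ℝ≥0 where
  toFun x := ⟨spectralNorm ℚ_[p] F x, spectralNorm_nonneg x⟩
  map_zero' := Subtype.ext spectralNorm_zero
  map_one' := Subtype.ext spectralNorm_one
  map_mul' x y := Subtype.ext ((spectralMulAlgNorm ℚ_[p] F).map_mul' x y)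
  map_add_le_max' x y := isNonarchimedean_spectralNorm x y

variable {F : Type*} [Field F] [Algebra ℚ_[p] F] [Algebra.IsAlgebraic ℚ_[p] F]

theorem coe_padicVal (x : F) : (padicVal p F x : ℝ) = spectralNorm ℚ_[p] F x := rfl

/-- The spectral norm is at most `1` exactly when the minimal polynomial over `ℚ_[p]` has
coefficients in `ℤ_[p]`; since `ℤ_[p]` is integrally closed, this is integrality. -/
theorem padicVal_le_one_iff {x : F} : padicVal p F x ≤ 1 ↔ x ∈ ringOfIntegers p F := by
  let : Algebra ℤ_[p] F := Algebra.compHom F (algebraMap ℤ_[p] ℚ_[p])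
  have : IsScalarTower ℤ_[p] ℚ_[p] F := IsScalarTower.of_algebraMap_eq fun _ => rfl
  have hx : IsIntegral ℚ_[p] x := Algebra.IsIntegral.isIntegral x
  have h1 : padicVal p F x ≤ 1 ↔ ∀ n, ‖(minpoly ℚ_[p] x).coeff n‖ ≤ 1 := by
    rw [← spectralValue_le_one_iff (minpoly.monic hx), ← NNReal.coe_le_coe, coe_padicVal]
    rfl
  rw [h1]
  change _ ↔ IsIntegral ℤ_[p] x
  constructor
  · intro h
    have hl : minpoly ℚ_[p] x ∈ Polynomial.lifts (algebraMap ℤ_[p] ℚ_[p]) := by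
      rw [Polynomial.lifts_iff_coeff_lifts]
      exact fun n => ⟨⟨_, h n⟩, rfl⟩
    obtain ⟨q, hq, -, hm⟩ := Polynomial.lifts_and_degree_eq_and_monic hl (minpoly.monic hx)
    refine ⟨q, hm, ?_⟩
    have := minpoly.aeval ℚ_[p] x
    rw [← hq, Polynomial.aeval_map_algebraMap] at this
    exact this
  · intro h n
    rw [minpoly.isIntegrallyClosed_eq_field_fractions' ℚ_[p] h, Polynomial.coeff_map]
    exact PadicInt.norm_le_one _

theorem padicVal_map {F' : Type*} [Field F'] [Algebra ℚ_[p] F'] [Algebra.IsAlgebraic ℚ_[p] F']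
    (f : F →ₐ[ℚ_[p]] F') (x : F) : padicVal p F' (f x) = padicVal p F x := by
  apply Subtype.ext
  change spectralValue (minpoly ℚ_[p] (f x)) = spectralValue (minpoly ℚ_[p] x)
  rw [minpoly.algHom_eq f f.injective]

theorem padicVal_prime_lt_one : padicVal p F p < 1 := by
  rw [← map_natCast (algebraMap ℚ_[p] F), ← NNReal.coe_lt_coe, coe_padicVal, spectralNorm_extends]
  simpa using inv_lt_one_of_one_lt₀ (by exact_mod_cast (Fact.out : p.Prime).one_lt : (1 : ℝ) < p)

theorem padicVal_prime_pos : 0 < padicVal p F p := by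
  have : CharZero F := charZero_of_injective_algebraMap (algebraMap ℚ_[p] F).injective
  rw [Valuation.pos_iff]
  exact_mod_cast (Fact.out : p.Prime).ne_zero

theorem padicVal_natCast_le_one (n : ℕ) : padicVal p F n ≤ 1 :=
  (padicVal_le_one_iff p).2 (natCast_mem _ n)

theorem padicVal_natCast_eq_one {n : ℕ} (hn : ¬ p ∣ n) : padicVal p F n = 1 := by
  rw [← map_natCast (algebraMap ℚ_[p] F)]
  apply Subtype.ext
  change spectralNorm ℚ_[p] F _ = 1
  rw [spectralNorm_extends]
  exact (Padic.norm_natCast_eq_one_iff ..).2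
    ((Nat.Prime.coprime_iff_not_dvd Fact.out).2 hn)

/-- The norm of `x` to the degree of its minimal polynomial is the norm of the constant term, a
power of `p`. This makes the value group discrete. -/
theorem exists_padicVal_pow_eq [FiniteDimensional ℚ_[p] F] {x : F} (hx : x ≠ 0) :
    ∃ k : ℤ, padicVal p F x ^ Module.finrank ℚ_[p] F = (p : ℝ≥0) ^ k := by
  have hxi : IsIntegral ℚ_[p] x := Algebra.IsIntegral.isIntegral x
  obtain ⟨m, hm⟩ : (minpoly ℚ_[p] x).natDegree ∣ Module.finrank ℚ_[p] F := minpoly.degree_dvd hxi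
  have h0 : (minpoly ℚ_[p] x).coeff 0 ≠ 0 := minpoly.coeff_zero_ne_zero hxi hx
  obtain ⟨k, hk⟩ := _root_.Padic.padicNormE.image h0
  refine ⟨-k * m, NNReal.coe_injective ?_⟩
  have hd : (0 : ℝ) < (minpoly ℚ_[p] x).natDegree := by
    exact_mod_cast minpoly.natDegree_pos hxi
  have h1 : (padicVal p F x : ℝ) ^ (minpoly ℚ_[p] x).natDegree = (p : ℝ) ^ (-k) := by
    rw [coe_padicVal, spectralNorm.spectralNorm_eq_norm_coeff_zero_rpow, ← Real.rpow_natCast,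
      ← Real.rpow_mul (norm_nonneg _), one_div, inv_mul_cancel₀ hd.ne', Real.rpow_one, hk]
    push_cast
    rfl
  push_cast
  rw [hm, pow_mul, h1, zpow_mul, zpow_natCast]

theorem exists_uniformizer [FiniteDimensional ℚ_[p] F] :
    ∃ π : F, 0 < padicVal p F π ∧ padicVal p F π < 1 ∧
      ∀ x : F, x ≠ 0 → ∃ n : ℤ, padicVal p F x = padicVal p F π ^ n := by
  have hN : Module.finrank ℚ_[p] F ≠ 0 := Module.finrank_pos.ne'
  have hp1 : (1 : ℝ≥0) < p := by exact_mod_cast (Fact.out : p.Prime).one_lt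
  have hp0 : (p : ℝ≥0) ≠ 0 := (zero_lt_one.trans hp1).ne'
  -- The exponents that occur form a subgroup of `ℤ`, hence a cyclic one. It is nonzero because of
  -- `p`, and its negative generator comes from a uniformizer.
  let S : AddSubgroup ℤ :=
    { carrier := {k | ∃ x : F, x ≠ 0 ∧ padicVal p F x ^ Module.finrank ℚ_[p] F = (p : ℝ≥0) ^ k}
      zero_mem' := ⟨1, one_ne_zero, by simp⟩
      add_mem' := by
        rintro k l ⟨x, hx, hxk⟩ ⟨y, hy, hyl⟩
        exact ⟨x * y, mul_ne_zero hx hy, by rw [map_mul, mul_pow, hxk, hyl, zpow_add₀ hp0]⟩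
      neg_mem' := by
        rintro k ⟨x, hx, hxk⟩
        exact ⟨x⁻¹, inv_ne_zero hx, by rw [map_inv₀, inv_pow, hxk, zpow_neg]⟩ }
  have key : ∀ a : ℤ, a < 0 → S = AddSubgroup.closure {a} → ∃ π : F, 0 < padicVal p F π ∧
      padicVal p F π < 1 ∧ ∀ x : F, x ≠ 0 → ∃ n : ℤ, padicVal p F x = padicVal p F π ^ n := by
    intro a ha hS
    obtain ⟨π, hπ0, hπ⟩ : a ∈ S := hS ▸ AddSubgroup.subset_closure rfl
    refine ⟨π, (Valuation.pos_iff _).2 hπ0, ?_, fun x hx => ?_⟩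
    · rw [← pow_lt_one_iff_of_nonneg (zero_le) hN, hπ]
      exact zpow_lt_one_of_neg₀ hp1 ha
    · obtain ⟨k, hk⟩ := exists_padicVal_pow_eq p hx
      have hkS : k ∈ S := ⟨x, hx, hk⟩
      rw [hS, AddSubgroup.mem_closure_singleton] at hkS
      obtain ⟨n, rfl⟩ := hkS
      refine ⟨n, (pow_left_inj₀ zero_le zero_le hN).1 ?_⟩
      rw [hk, smul_eq_mul, mul_comm, zpow_mul, ← hπ, ← zpow_natCast, ← zpow_natCast, ← zpow_mul,
        ← zpow_mul, mul_comm]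
  obtain ⟨a, ha⟩ := Int.subgroup_cyclic S
  rcases lt_trichotomy a 0 with h | h | h
  · exact key a h ha
  · exfalso
    have hpF : (p : F) ≠ 0 := (Valuation.pos_iff _).1 (padicVal_prime_pos p)
    obtain ⟨k, hk⟩ := exists_padicVal_pow_eq p hpF
    have hkS : k ∈ S := ⟨p, hpF, hk⟩
    rw [ha, h, AddSubgroup.mem_closure_singleton] at hkS
    obtain ⟨n, rfl⟩ := hkS
    simp only [smul_zero, zpow_zero] at hk
    exact (pow_lt_one₀ (zero_le) (padicVal_prime_lt_one p) hN).ne hk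
  · refine key (-a) (by omega) (ha.trans ?_)
    rw [← AddSubgroup.zmultiples_eq_closure, ← AddSubgroup.zmultiples_eq_closure,
      AddSubgroup.zmultiples_neg]

/-- Here `q` is the cardinality of the residue field. The lemma reduces statements about units to
elements of the maximal ideal. -/
theorem exists_natCast_pow_sub [FiniteDimensional ℚ_[p] F] :
    ∃ q : ℕ, padicVal p F q < 1 ∧
      ∀ x : F, padicVal p F x ≤ 1 → padicVal p F (x ^ q - x) < 1 := by
  let : Algebra ℤ_[p] F := Algebra.compHom F (algebraMap ℤ_[p] ℚ_[p])
  have : IsScalarTower ℤ_[p] ℚ_[p] F := IsScalarTower.of_algebraMap_eq fun _ => rfl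
  let S := integralClosure ℤ_[p] F
  have hS : ∀ x : F, x ∈ S ↔ padicVal p F x ≤ 1 := fun x => (padicVal_le_one_iff p).symm
  have hfin : Module.Finite ℤ_[p] S := IsIntegralClosure.finite ℤ_[p] ℚ_[p] F S
  have hu : ∀ x : S, x ∈ nonunits S ↔ padicVal p F x < 1 := by
    intro x
    rw [lt_iff_le_and_ne, mem_nonunits_iff, and_iff_right ((hS x).1 x.2), not_iff_not]
    constructor
    · rintro ⟨u, rfl⟩
      have h1 := (hS _).1 (u : S).2
      have h2 := (hS _).1 ((u⁻¹ : Sˣ) : S).2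
      have h3 : padicVal p F (u : S) * padicVal p F ((u⁻¹ : Sˣ) : S) = 1 := by
        rw [← map_mul, ← MulMemClass.coe_mul, u.mul_inv]; simp
      refine h1.antisymm ?_
      rw [← h3]
      exact mul_le_of_le_one_right (zero_le) h2
    · intro h
      have h0 : (x : F) ≠ 0 := by
        intro h0
        simp [h0] at h
      refine IsUnit.of_mul_eq_one (⟨(x : F)⁻¹, (hS _).2 (by rw [map_inv₀, h, inv_one])⟩ : S)
        (Subtype.ext (mul_inv_cancel₀ h0))
  have hloc : IsLocalRing S := IsLocalRing.of_nonunits_add fun a b ha hb => by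
    rw [hu] at ha hb ⊢
    exact Valuation.map_add_lt _ ha hb
  have hfr : Finite (IsLocalRing.ResidueField ℤ_[p]) :=
    Finite.of_equiv _ (PadicInt.residueField (p := p)).symm.toEquiv
  have : IsLocalHom (algebraMap ℤ_[p] S) :=
    (algebraMap_isIntegral_iff.2 inferInstance : (algebraMap ℤ_[p] S).IsIntegral).isLocalHom
      (Function.Injective.of_comp (f := (Subtype.val : S → F))
        ((algebraMap ℚ_[p] F).injective.comp (IsFractionRing.injective ℤ_[p] ℚ_[p])))
  have hfk : Finite (IsLocalRing.ResidueField S) :=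
    IsLocalRing.ResidueField.finite_of_finite hfr
  have := Fintype.ofFinite (IsLocalRing.ResidueField S)
  refine ⟨Fintype.card (IsLocalRing.ResidueField S), ?_, fun x hx => ?_⟩
  · have := (hu (Fintype.card (IsLocalRing.ResidueField S) : S)).1 <| by
      rw [← IsLocalRing.mem_maximalIdeal, ← IsLocalRing.residue_eq_zero_iff, map_natCast]
      exact FiniteField.cast_card_eq_zero _
    simpa using this
  · have := (hu ((⟨x, (hS x).2 hx⟩ : S) ^ Fintype.card (IsLocalRing.ResidueField S) -
      ⟨x, (hS x).2 hx⟩)).1 <| by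
      rw [← IsLocalRing.mem_maximalIdeal, ← IsLocalRing.residue_eq_zero_iff, map_sub, map_pow,
        FiniteField.pow_card, sub_self]
    simpa using this

/-- The derivative of `x ^ p` at `1` is `p ≠ 0`, so by the inverse function theorem over the
complete field `F` the `p`-th powers contain a neighbourhood of `1`. -/
theorem exists_pow_prime_eq_one_add [FiniteDimensional ℚ_[p] F] :
    ∃ ε : ℝ≥0, 0 < ε ∧ ∀ y : F, padicVal p F y < ε → ∃ s : F, s ^ p = 1 + y := by
  let := spectralNorm.nontriviallyNormedField ℚ_[p] F
  have : CompleteSpace F := spectralNorm.completeSpace ℚ_[p] F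
  have : CharZero F := charZero_of_injective_algebraMap (algebraMap ℚ_[p] F).injective
  have hd : HasStrictDerivAt (fun x : F => x ^ p) ((p : F) * 1 ^ (p - 1)) 1 :=
    hasStrictDerivAt_pow p 1
  have hm := hd.map_nhds_eq (by simpa using (Fact.out : p.Prime).ne_zero)
  rw [one_pow] at hm
  have hr : Set.range (fun x : F => x ^ p) ∈ nhds (1 : F) := by
    rw [← hm]; exact Filter.mem_map.2 (by simp)
  obtain ⟨ε, hε, h⟩ := Metric.mem_nhds_iff.1 hr
  refine ⟨⟨ε, hε.le⟩, hε, fun y hy => ?_⟩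
  have : 1 + y ∈ Metric.ball (1 : F) ε := by
    rw [mem_ball_iff_norm, add_sub_cancel_left]
    exact hy
  exact h this

end PadicValuation

/-! ### Estimates for sums and for powers of `1 + w` -/

section ValuationEstimates

variable {F : Type*} [Field F] (v : Valuation F ℝ≥0)

theorem valuation_natCast_le_one (n : ℕ) : v n ≤ 1 := by
  induction n with
  | zero => simp
  | succ n ih => rw [Nat.cast_succ]; exact v.map_add_le ih v.map_one.le

/-- The valuation of a sum whose nonzero terms have distinct valuations. -/
theorem map_sum_eq_sup {ι : Type*} (s : Finset ι) (f : ι → F)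
    (hf : ∀ i ∈ s, ∀ j ∈ s, v (f i) = v (f j) → f i ≠ 0 → i = j) :
    v (∑ i ∈ s, f i) = s.sup fun i => v (f i) := by
  classical
  induction s using Finset.induction_on with
  | empty => simp
  | insert a s ha ih =>
    rw [Finset.sum_insert ha, Finset.sup_insert]
    have ih := ih fun i hi j hj =>
      hf i (Finset.mem_insert_of_mem hi) j (Finset.mem_insert_of_mem hj)
    by_cases h0 : f a = 0
    · rw [h0, zero_add, ih, map_zero]
      simp
    · rw [← ih]
      refine v.map_add_of_distinct_val fun h => ?_
      rcases s.eq_empty_or_nonempty with rfl | hs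
      · exact h0 (v.zero_iff.1 (by simpa using h))
      · obtain ⟨i, hi, hi'⟩ := Finset.exists_mem_eq_sup s hs fun i => v (f i)
        rw [ih, hi'] at h
        exact ha (hf a (Finset.mem_insert_self _ _) i (Finset.mem_insert_of_mem hi) h h0 ▸ hi)

theorem map_one_add_pow_sub_le {w : F} (hw : v w ≤ 1) (n : ℕ) :
    v ((1 + w) ^ n - 1 - n * w) ≤ v w ^ 2 := by
  induction n with
  | zero => simp
  | succ n ih =>
    have : (1 + w) ^ (n + 1) - 1 - ((n + 1 : ℕ) : F) * w =
        (1 + w) * ((1 + w) ^ n - 1 - n * w) + n * w ^ 2 := by push_cast; ring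
    rw [this]
    refine v.map_add_le ?_ ?_
    · rw [map_mul]
      exact (mul_le_of_le_one_left zero_le (v.map_add_le v.map_one.le hw)).trans ih
    · rw [map_mul, map_pow]
      exact mul_le_of_le_one_left zero_le (valuation_natCast_le_one v n)

theorem map_one_add_pow_sub_one {w : F} (hw : v w < 1) {n : ℕ} (hn : v n = 1) :
    v ((1 + w) ^ n - 1) = v w := by
  by_cases h0 : w = 0
  · simp [h0]
  have h1 : v (n * w) = v w := by rw [map_mul, hn, one_mul]
  have h2 := map_one_add_pow_sub_le v hw.le n
  have h3 : v w ^ 2 < v w := by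
    rw [pow_two]
    exact mul_lt_of_lt_one_left ((Valuation.pos_iff v).2 h0) hw
  rw [show (1 + w) ^ n - 1 = ((1 + w) ^ n - 1 - n * w) + n * w by ring,
    v.map_add_eq_of_lt_right (by rw [h1]; exact h2.trans_lt h3), h1]

theorem map_one_add_pow_sub_one_le {w : F} (hw : v w ≤ 1) (n : ℕ) :
    v ((1 + w) ^ n - 1) ≤ v w := by
  rw [show (1 + w) ^ n - 1 = ((1 + w) ^ n - 1 - n * w) + n * w by ring]
  refine v.map_add_le ((map_one_add_pow_sub_le v hw n).trans ?_) ?_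
  · rw [pow_two]; exact mul_le_of_le_one_left zero_le hw
  · rw [map_mul]; exact mul_le_of_le_one_left zero_le (valuation_natCast_le_one v n)

variable {p : ℕ} (hp : p.Prime)
include hp

theorem map_add_pow_prime_sub_le {x y : F} {M : ℝ≥0} (hx : v x ≤ M) (hy : v y ≤ M) :
    v ((x + y) ^ p - (x ^ p + y ^ p)) ≤ v p * M ^ p := by
  rw [add_pow_prime_eq' hp x y, add_sub_cancel_left, map_mul]
  refine mul_le_mul_right (v.map_sum_le fun k hk => ?_) _
  rw [Finset.mem_Ioo] at hk
  rw [map_mul, map_mul, map_pow, map_pow]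
  refine (mul_le_of_le_one_right zero_le (valuation_natCast_le_one v _)).trans ?_
  calc v x ^ k * v y ^ (p - k) ≤ M ^ k * M ^ (p - k) := by gcongr
    _ = M ^ p := by rw [← pow_add]; congr 1; omega

theorem map_sum_pow_prime_sub_le {ι : Type*} (s : Finset ι) (f : ι → F) {M : ℝ≥0}
    (hf : ∀ i ∈ s, v (f i) ≤ M) :
    v ((∑ i ∈ s, f i) ^ p - ∑ i ∈ s, f i ^ p) ≤ v p * M ^ p := by
  classical
  induction s using Finset.induction_on with
  | empty => simp [hp.ne_zero]
  | insert a s ha ih =>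
    have hs : ∀ i ∈ s, v (f i) ≤ M := fun i hi => hf i (Finset.mem_insert_of_mem hi)
    rw [Finset.sum_insert ha, Finset.sum_insert ha]
    have h1 := map_add_pow_prime_sub_le v hp (hf a (Finset.mem_insert_self _ _))
      (v.map_sum_le hs)
    rw [show (f a + ∑ i ∈ s, f i) ^ p - (f a ^ p + ∑ i ∈ s, f i ^ p) =
      ((f a + ∑ i ∈ s, f i) ^ p - (f a ^ p + (∑ i ∈ s, f i) ^ p)) +
        ((∑ i ∈ s, f i) ^ p - ∑ i ∈ s, f i ^ p) by ring]
    exact v.map_add_le h1 (ih hs)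

theorem map_one_add_pow_prime_sub_le {z : F} (hz : v z ≤ 1) :
    v ((1 + z) ^ p - (1 + p * z + z ^ p)) ≤ v p * v z ^ 2 := by
  have hI : Finset.Ioo 0 p = insert 1 (Finset.Ioo 1 p) := by
    ext k
    have := hp.one_lt
    simp only [Finset.mem_Ioo, Finset.mem_insert]
    omega
  have h : (1 + z) ^ p - (1 + p * z + z ^ p) =
      p * ∑ k ∈ Finset.Ioo 1 p, z ^ k * 1 ^ (p - k) * ((p.choose k / p : ℕ) : F) := by
    rw [add_comm 1 z, add_pow_prime_eq' hp z 1, hI, Finset.sum_insert (by simp)]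
    simp only [Nat.choose_one_right, Nat.div_self hp.pos]
    push_cast
    ring
  rw [h, map_mul]
  refine mul_le_mul_right (v.map_sum_le fun k hk => ?_) _
  rw [Finset.mem_Ioo] at hk
  rw [map_mul, map_mul, map_pow, one_pow, map_one, mul_one]
  exact (mul_le_of_le_one_right zero_le (valuation_natCast_le_one v _)).trans
    (pow_le_pow_of_le_one zero_le hz hk.1)

/-- `(1 + w) ^ p - 1 = w ^ p + p w u` with a unit `u`. -/
theorem map_one_add_pow_prime_sub_sub {w : F} (hw : v w < 1) :
    v ((1 + w) ^ p - 1 - w ^ p) = v p * v w := by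
  have h := map_one_add_pow_prime_sub_le v hp hw.le
  by_cases h0 : (p : F) * w = 0
  · rcases mul_eq_zero.1 h0 with h1 | h1
    · rw [h1, map_zero, zero_mul, zero_mul, nonpos_iff_eq_zero, v.zero_iff, add_zero] at h
      rw [sub_sub, h, h1, map_zero, zero_mul]
    · simp [h1, hp.ne_zero]
  · have h1 : v p * v w ^ 2 < v (p * w) := by
      rw [pow_two, ← mul_assoc, ← map_mul]
      exact mul_lt_of_lt_one_right ((Valuation.pos_iff v).2 h0) hw
    rw [show (1 + w) ^ p - 1 - w ^ p = ((1 + w) ^ p - (1 + p * w + w ^ p)) + p * w by ring,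
      v.map_add_eq_of_lt_right (h.trans_lt h1), map_mul]

end ValuationEstimates

/-! ### Expansion in powers of a uniformizer, and successive approximation of a `p`-th root -/

section PowerSums

variable {p : ℕ} {K L : Type*} [Field K] [Field L] [Algebra K L]
  (v : Valuation L ℝ≥0) {π : L} (hπ0 : 0 < v π) (hπ1 : v π < 1)
  (hK : ∀ c : K, c ≠ 0 → ∃ n : ℤ, v (algebraMap K L c) = v π ^ (p * n))
include hπ0 hπ1 hK

omit hπ1 in
theorem exists_map_smul_pow_eq {c : K} (hc : c ≠ 0) (i : ℕ) :
    ∃ n : ℤ, v (c • π ^ i) = v π ^ (p * n + i) := by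
  obtain ⟨n, hn⟩ := hK c hc
  exact ⟨n, by rw [Algebra.smul_def, map_mul, map_pow, hn, zpow_add₀ hπ0.ne', zpow_natCast]⟩

/-- The exponent of `v (c • π ^ i)` is congruent to `i` modulo `p`, so nonzero terms of a power sum
never share a valuation. -/
theorem eq_of_map_smul_pow_eq {c d : K} {i j : Fin p}
    (hij : v (c • π ^ (i : ℕ)) = v (d • π ^ (j : ℕ))) (h0 : c • π ^ (i : ℕ) ≠ 0) : i = j := by
  have hc : c ≠ 0 := fun h => h0 (by simp [h])
  have hd : d ≠ 0 := by
    rintro h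
    rw [h, zero_smul, map_zero, v.zero_iff] at hij
    exact h0 hij
  obtain ⟨n, hn⟩ := exists_map_smul_pow_eq v hπ0 hK hc i
  obtain ⟨m, hm⟩ := exists_map_smul_pow_eq v hπ0 hK hd j
  rw [hn, hm] at hij
  have h1 := zpow_right_injective₀ hπ0 hπ1.ne hij
  have h2 := i.2
  have h3 := j.2
  have h4 : ((p * n + i : ℤ)) % p = (p * m + j : ℤ) % p := by rw [h1]
  rw [Int.mul_add_emod_self_left, Int.mul_add_emod_self_left, Int.emod_eq_of_lt (by omega)
    (by omega), Int.emod_eq_of_lt (by omega) (by omega)] at h4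
  exact Fin.ext (by exact_mod_cast h4)

theorem map_powSum_eq_sup (c : Fin p → K) :
    v (∑ i, c i • π ^ (i : ℕ)) = Finset.univ.sup fun i => v (c i • π ^ (i : ℕ)) :=
  map_sum_eq_sup v _ _ fun _ _ _ _ hij h0 => eq_of_map_smul_pow_eq v hπ0 hπ1 hK hij h0

theorem map_smul_pow_le (c : Fin p → K) (i : Fin p) :
    v (c i • π ^ (i : ℕ)) ≤ v (∑ i, c i • π ^ (i : ℕ)) := by
  rw [map_powSum_eq_sup v hπ0 hπ1 hK]
  exact Finset.le_sup (f := fun i : Fin p => v (c i • π ^ (i : ℕ))) (Finset.mem_univ i)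

theorem linearIndependent_pow : LinearIndependent K fun i : Fin p => π ^ (i : ℕ) := by
  rw [Fintype.linearIndependent_iff]
  intro c hc i
  have h := map_smul_pow_le v hπ0 hπ1 hK c i
  rw [hc, map_zero, nonpos_iff_eq_zero, v.zero_iff, smul_eq_zero] at h
  exact h.resolve_right (pow_ne_zero _ ((Valuation.pos_iff v).1 hπ0))

theorem exists_eq_powSum (hp : 0 < p) (hdeg : Module.finrank K L = p) (x : L) :
    ∃ c : Fin p → K, x = ∑ i, c i • π ^ (i : ℕ) := by
  have : Nonempty (Fin p) := ⟨⟨0, hp⟩⟩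
  let b := basisOfLinearIndependentOfCardEqFinrank (linearIndependent_pow v hπ0 hπ1 hK)
    (by simp [hdeg])
  refine ⟨b.repr x, ?_⟩
  conv_lhs => rw [← b.sum_repr x]
  simp [b]

/-- The approximation step: if `π ^ p = a (1 + y)` with `y` small, then the uniformizer `π` of `L`
can be modified so that `y` becomes smaller. -/
theorem exists_better_root (hp : p.Prime) (hpL : (p : L) ≠ 0) (hdeg : Module.finrank K L = p)
    {a : K} {y : L} (ha : π ^ p = algebraMap K L a * (1 + y)) {n : ℕ} (hn : 1 ≤ n)
    (hy : v y ≤ v p * v π ^ n) :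
    ∃ (π' : L) (a' : K) (y' : L), v π' = v π ∧ π' ^ p = algebraMap K L a' * (1 + y') ∧
      v y' ≤ v p * v π ^ (n + 1) := by
  set ρ := v π with hρ
  have hp1 : v p ≤ 1 := valuation_natCast_le_one v p
  have hpow : ∀ m, n + 1 ≤ m → v p * ρ ^ m ≤ v p * ρ ^ (n + 1) := fun m hm =>
    mul_le_mul_right (pow_le_pow_of_le_one zero_le hπ1.le hm) _
  have hn1 : ρ ^ n < 1 := pow_lt_one₀ zero_le hπ1 (by omega)
  have hy1 : v y < 1 := (hy.trans (mul_le_of_le_one_left zero_le hp1)).trans_lt hn1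
  have h2p := hp.two_le
  -- Chosen so that the linear term `p z` of `(1 + z) ^ p` cancels `y`; up to small terms `(1 + y)
  -- (1 + z) ^ p` is then `1 + z ^ p`.
  set z : L := -y / p with hz
  have hpz : p * z = -y := by rw [hz]; field_simp
  have hvz : v z ≤ ρ ^ n := by
    rw [hz, map_div₀, v.map_neg]
    exact div_le_of_le_mul₀ zero_le zero_le (by rwa [mul_comm])
  have hz1 : v z < 1 := hvz.trans_lt hn1
  obtain ⟨c, hc⟩ := exists_eq_powSum v hπ0 hπ1 hK hp.pos hdeg z
  have hcz : ∀ i, v (c i • π ^ (i : ℕ)) ≤ ρ ^ n := fun i => by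
    refine (map_smul_pow_le v hπ0 hπ1 hK c i).trans ?_
    rwa [← hc]
  -- An element of `K` close to `z ^ p`: the `p`-th power is additive up to multiples of `p`, and `π
  -- ^ p` is close to `a`. It is absorbed into the new `a`.
  set u : K := ∑ i, c i ^ p * a ^ (i : ℕ) with hu
  have hnp : n + 1 ≤ n * p := by nlinarith
  have h1 : v (z ^ p - algebraMap K L u) ≤ v p * ρ ^ (n + 1) := by
    have e : z ^ p - algebraMap K L u = (z ^ p - ∑ i, (c i • π ^ (i : ℕ)) ^ p) +
        ∑ i, ((c i • π ^ (i : ℕ)) ^ p - algebraMap K L (c i ^ p * a ^ (i : ℕ))) := by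
      rw [hu, map_sum, Finset.sum_sub_distrib]; ring
    rw [e]
    refine v.map_add_le ?_ (v.map_sum_le fun i _ => ?_)
    · conv_lhs => rw [hc]
      refine (map_sum_pow_prime_sub_le v hp _ _ fun i _ => hcz i).trans ?_
      rw [← pow_mul]
      exact hpow _ hnp
    · have e2 : (c i • π ^ (i : ℕ)) ^ p - algebraMap K L (c i ^ p * a ^ (i : ℕ)) =
          algebraMap K L (c i ^ p * a ^ (i : ℕ)) * ((1 + y) ^ (i : ℕ) - 1) := by
        rw [Algebra.smul_def, mul_pow, ← pow_mul, mul_comm (i : ℕ) p, pow_mul, ha, mul_pow]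
        simp only [map_mul, map_pow]
        ring
      have e3 : v (algebraMap K L (c i ^ p * a ^ (i : ℕ))) = v (c i • π ^ (i : ℕ)) ^ p := by
        rw [← map_pow v, Algebra.smul_def, mul_pow, ← pow_mul, mul_comm (i : ℕ) p, pow_mul, ha,
          mul_pow]
        simp only [map_mul, map_pow, v.map_one_add_of_lt hy1, one_pow, mul_one]
      rw [e2, map_mul, e3]
      calc v (c i • π ^ (i : ℕ)) ^ p * v ((1 + y) ^ (i : ℕ) - 1)
          ≤ (ρ ^ n) ^ p * (v p * ρ ^ n) := by
            gcongr
            · exact hcz i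
            · exact (map_one_add_pow_sub_one_le v hy1.le _).trans hy
        _ = v p * ρ ^ (n * p + n) := by rw [pow_add, pow_mul]; ring
        _ ≤ _ := hpow _ (by omega)
  have hvu : v (algebraMap K L u) < 1 := by
    rw [show algebraMap K L u = z ^ p - (z ^ p - algebraMap K L u) by ring]
    refine v.map_sub_lt ?_ (h1.trans_lt ?_)
    · rw [map_pow]; exact pow_lt_one₀ zero_le hz1 hp.ne_zero
    · exact (mul_le_of_le_one_left zero_le hp1).trans_lt
        (pow_lt_one₀ zero_le hπ1 (by omega))
  have hvu1 : v (1 + algebraMap K L u) = 1 := v.map_one_add_of_lt hvu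
  have hu0 : 1 + algebraMap K L u ≠ 0 := fun h => by simp [h] at hvu1
  set e := (1 + y) * (1 + z) ^ p - (1 + algebraMap K L u) with he
  have hve : v e ≤ v p * ρ ^ (n + 1) := by
    set R := (1 + z) ^ p - (1 + p * z + z ^ p) with hR
    have hvR : v R ≤ v p * ρ ^ (n + 1) := by
      refine (map_one_add_pow_prime_sub_le v hp hz1.le).trans ?_
      calc v p * v z ^ 2 ≤ v p * (ρ ^ n) ^ 2 := by gcongr
        _ = v p * ρ ^ (n * 2) := by rw [pow_mul]
        _ ≤ _ := hpow _ (by omega)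
    have e1 : e = -y ^ 2 + (z ^ p - algebraMap K L u) + y * z ^ p + (1 + y) * R := by
      rw [he, hR, hpz]; ring
    rw [e1]
    refine v.map_add_le (v.map_add_le (v.map_add_le ?_ h1) ?_) ?_
    · rw [v.map_neg, map_pow]
      calc v y ^ 2 ≤ (v p * ρ ^ n) ^ 2 := by gcongr
        _ = v p * (v p * ρ ^ (n * 2)) := by rw [pow_mul]; ring
        _ ≤ v p * (1 * ρ ^ (n * 2)) := by gcongr
        _ ≤ _ := by rw [one_mul]; exact hpow _ (by omega)
    · rw [map_mul, map_pow]
      calc v y * v z ^ p ≤ (v p * ρ ^ n) * (ρ ^ n) ^ p := by gcongr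
        _ = v p * ρ ^ (n + n * p) := by rw [pow_add, pow_mul]; ring
        _ ≤ _ := hpow _ (by omega)
    · rw [map_mul, v.map_one_add_of_lt hy1, one_mul]
      exact hvR
  refine ⟨π * (1 + z), a * (1 + u), e / (1 + algebraMap K L u), ?_, ?_, ?_⟩
  · rw [map_mul, v.map_one_add_of_lt hz1, mul_one]
  · rw [mul_pow, ha, map_mul, map_add, map_one]
    field_simp
    rw [he]
    ring
  · rw [map_div₀, hvu1, div_one]
    exact hve

-- The value `ρ` is fixed in advance because `π` changes at each step while its valuation does not.
omit hπ0 hπ1 hK in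
theorem exists_approximate_root (hp : p.Prime) (hpL : (p : L) ≠ 0)
    (hdeg : Module.finrank K L = p) {ρ : ℝ≥0} (hρ0 : 0 < ρ) (hρ1 : ρ < 1)
    (hK : ∀ c : K, c ≠ 0 → ∃ n : ℤ, v (algebraMap K L c) = ρ ^ (p * n))
    (h : ∃ (π : L) (a : K) (y : L), v π = ρ ∧ π ^ p = algebraMap K L a * (1 + y) ∧
      v y ≤ v p * ρ) (n : ℕ) :
    ∃ (π : L) (a : K) (y : L), v π = ρ ∧ π ^ p = algebraMap K L a * (1 + y) ∧
      v y ≤ v p * ρ ^ (n + 1) := by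
  induction n with
  | zero => simpa using h
  | succ n ih =>
    obtain ⟨π, a, y, rfl, ha, hy⟩ := ih
    exact exists_better_root v hρ0 hρ1 hK hp hpL hdeg ha (by omega) hy

end PowerSums

/-! ### Galois theory of the normal closure in prime degree -/

section NormalClosureOfPrimeDegree

variable {p : ℕ} (K L E : Type*) [Field K] [Field L] [Algebra K L] [Field E] [Algebra K E]
  [IsNormalClosure K L E]

theorem normalClosure_eq_top_of_isNormalClosure [FiniteDimensional K L] :
    IntermediateField.normalClosure K L E = ⊤ :=
  (Algebra.IsAlgebraic.isNormalClosure_iff.1 inferInstance).2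

theorem finiteDimensional_of_isNormalClosure [FiniteDimensional K L] : FiniteDimensional K E := by
  have : FiniteDimensional K (⊤ : IntermediateField K E) := by
    rw [← normalClosure_eq_top_of_isNormalClosure K L E]
    infer_instance
  exact IntermediateField.topEquiv.toLinearEquiv.finiteDimensional

variable [CharZero K]

/-- The Galois group of the normal closure of `L/K` acts faithfully on the embeddings of `L`. -/
theorem card_gal_dvd_factorial [FiniteDimensional K L] :
    Nat.card (E ≃ₐ[K] E) ∣ (Module.finrank K L).factorial := by
  let φ : (E ≃ₐ[K] E) →* Equiv.Perm (L →ₐ[K] E) :=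
    { toFun := fun σ =>
        { toFun := fun f => (σ : E →ₐ[K] E).comp f
          invFun := fun f => ((σ⁻¹ : E ≃ₐ[K] E) : E →ₐ[K] E).comp f
          left_inv := fun f => AlgHom.ext fun x => σ.symm_apply_apply (f x)
          right_inv := fun f => AlgHom.ext fun x => σ.apply_symm_apply (f x) }
      map_one' := rfl
      map_mul' := fun _ _ => rfl }
  have hφ : Function.Injective φ := by
    rw [injective_iff_map_eq_one]
    intro σ hσ
    have h : IntermediateField.normalClosure K L E ≤
        IntermediateField.fixedField (Subgroup.zpowers σ) := by
      refine iSup_le fun f => ?_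
      rintro _ ⟨x, rfl⟩
      rw [IntermediateField.mem_fixedField_iff]
      have h1 : σ (f x) = f x := DFunLike.congr_fun (DFunLike.congr_fun hσ f) x
      intro τ hτ
      have h2 : Subgroup.zpowers σ ≤ MulAction.stabilizer (E ≃ₐ[K] E) (f x) := by
        rw [Subgroup.zpowers_le]
        exact h1
      exact h2 hτ
    rw [normalClosure_eq_top_of_isNormalClosure, top_le_iff] at h
    ext x
    have hx : x ∈ IntermediateField.fixedField (Subgroup.zpowers σ) := h ▸ trivial
    exact (IntermediateField.mem_fixedField_iff _ _).1 hx σ (Subgroup.mem_zpowers σ)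
  have h1 := Subgroup.card_dvd_of_injective φ hφ
  rw [Nat.card_perm] at h1
  exact h1.trans (Nat.factorial_dvd_factorial (card_algHom_le_finrank K L E))

variable [Algebra L E] [IsScalarTower K L E] (hp : p.Prime) (hdeg : Module.finrank K L = p)
include hp hdeg

omit [Algebra L E] [IsScalarTower K L E] in
theorem isGalois_of_isNormalClosure : IsGalois K E := by
  have : FiniteDimensional K L := Module.finite_of_finrank_pos (hdeg ▸ hp.pos)
  have : Normal K E := IsNormalClosure.normal (F := K) (K := L) (L := E)
  exact ⟨⟩

/-- The order `p [E : L]` of the Galois group divides `p!`, so `[E : L]` divides `(p - 1)!`. -/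
theorem not_dvd_finrank_normalClosure : ¬ p ∣ Module.finrank L E := by
  have : FiniteDimensional K L := Module.finite_of_finrank_pos (hdeg ▸ hp.pos)
  have := finiteDimensional_of_isNormalClosure K L E
  have := isGalois_of_isNormalClosure K L E hp hdeg
  have h := card_gal_dvd_factorial K L E
  rw [IsGalois.card_aut_eq_finrank, ← Module.finrank_mul_finrank K L E, hdeg,
    ← Nat.mul_factorial_pred hp.ne_zero] at h
  have h2 := Nat.dvd_of_mul_dvd_mul_left hp.pos h
  intro h3
  have := (hp.dvd_factorial).1 (h3.trans h2)
  have := hp.pos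
  omega

-- Otherwise `σ` would be an automorphism of `E/L` of order `p`, although `p ∤ [E : L]`.
variable {E} in
theorem exists_ne_of_pow_prime_eq_one {σ : E ≃ₐ[K] E} (hσ : σ ≠ 1) (hσp : σ ^ p = 1) :
    ∃ x : L, σ (algebraMap L E x) ≠ algebraMap L E x := by
  have : FiniteDimensional K L := Module.finite_of_finrank_pos (hdeg ▸ hp.pos)
  have := finiteDimensional_of_isNormalClosure K L E
  have : FiniteDimensional L E := FiniteDimensional.right K L E
  have := isGalois_of_isNormalClosure K L E hp hdeg
  have : IsGalois L E := IsGalois.tower_top_of_isGalois K L E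
  by_contra! h
  have : Fact p.Prime := ⟨hp⟩
  let τ : E ≃ₐ[L] E := AlgEquiv.ofRingEquiv (f := (σ : E ≃+* E)) h
  have hτp : τ ^ p = 1 := by
    have h1 : ∀ n : ℕ, ∀ x, (τ ^ n) x = (σ ^ n) x := by
      intro n
      induction n with
      | zero => intro x; rfl
      | succ n ih => intro x; rw [pow_succ', pow_succ', AlgEquiv.mul_apply, ih]; rfl
    ext x
    rw [h1, hσp]
    rfl
  have hτ : τ ≠ 1 := fun h2 => hσ (AlgEquiv.ext fun x => DFunLike.congr_fun h2 x)
  have h1 := orderOf_dvd_natCard τ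
  rw [orderOf_eq_prime hτp hτ, IsGalois.card_aut_eq_finrank] at h1
  exact not_dvd_finrank_normalClosure K L E hp hdeg h1

theorem exists_gal_orderOf_eq : ∃ σ : E ≃ₐ[K] E, orderOf σ = p := by
  have : FiniteDimensional K L := Module.finite_of_finrank_pos (hdeg ▸ hp.pos)
  have := finiteDimensional_of_isNormalClosure K L E
  have := isGalois_of_isNormalClosure K L E hp hdeg
  have : Fact p.Prime := ⟨hp⟩
  refine exists_prime_orderOf_dvd_card' p ?_
  rw [IsGalois.card_aut_eq_finrank, ← Module.finrank_mul_finrank K L E, hdeg]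
  exact dvd_mul_right _ _

-- The elements of `L` fixed by `σ` form an intermediate field other than `L`; in prime degree only
-- `K` is left.
omit [IsNormalClosure K L E] [CharZero K] in
variable {L E} in
theorem mem_range_of_fixed {σ : E ≃ₐ[K] E} {y : L}
    (hy : σ (algebraMap L E y) ≠ algebraMap L E y) {x : L}
    (hx : σ (algebraMap L E x) = algebraMap L E x) : ∃ c : K, algebraMap K L c = x := by
  let M : IntermediateField K L :=
    (IntermediateField.fixedField (Subgroup.zpowers σ)).comap (IsScalarTower.toAlgHom K L E)
  have hM : ∀ z : L, z ∈ M ↔ σ (algebraMap L E z) = algebraMap L E z := by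
    intro z
    change algebraMap L E z ∈ IntermediateField.fixedField (Subgroup.zpowers σ) ↔ _
    rw [IntermediateField.mem_fixedField_iff]
    refine ⟨fun h => h σ (Subgroup.mem_zpowers σ), fun h τ hτ => ?_⟩
    have h2 : Subgroup.zpowers σ ≤ MulAction.stabilizer (E ≃ₐ[K] E) (algebraMap L E z) := by
      rw [Subgroup.zpowers_le]
      exact h
    exact h2 hτ
  have := IntermediateField.isSimpleOrder_of_finrank_prime K L (hdeg.symm ▸ hp)
  rcases eq_bot_or_eq_top M with h | h
  · exact IntermediateField.mem_bot.1 (h ▸ (hM x).2 hx)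
  · exact absurd ((hM y).1 (h ▸ trivial)) hy

end NormalClosureOfPrimeDegree

/-! ### Ramification groups in terms of a uniformizer -/

section Ramification

variable (p : ℕ) [Fact p.Prime] {K E : Type*} [Field K] [Algebra ℚ_[p] K] [Field E]
  [Algebra ℚ_[p] E] [Algebra K E] [IsScalarTower ℚ_[p] K E] [FiniteDimensional ℚ_[p] E]

omit [FiniteDimensional ℚ_[p] E] in
theorem padicVal_algEquiv [Algebra.IsAlgebraic ℚ_[p] E] (σ : E ≃ₐ[K] E) (x : E) :
    padicVal p E (σ x) = padicVal p E x :=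
  padicVal_map p ((σ : E →ₐ[K] E).restrictScalars ℚ_[p]) x

theorem isUnit_ringOfIntegers_iff {x : ringOfIntegers p E} :
    IsUnit x ↔ padicVal p E x = 1 := by
  constructor
  · rintro ⟨u, rfl⟩
    have h1 := (padicVal_le_one_iff p).2 (u : ringOfIntegers p E).2
    have h2 := (padicVal_le_one_iff p).2 ((u⁻¹ : (ringOfIntegers p E)ˣ) : ringOfIntegers p E).2
    have h3 : padicVal p E (u : ringOfIntegers p E) *
        padicVal p E ((u⁻¹ : (ringOfIntegers p E)ˣ) : ringOfIntegers p E) = 1 := by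
      rw [← map_mul, ← MulMemClass.coe_mul, u.mul_inv]; simp
    refine h1.antisymm ?_
    rw [← h3]
    exact mul_le_of_le_one_right zero_le h2
  · intro h
    have h0 : (x : E) ≠ 0 := by
      intro h0
      simp [h0] at h
    exact IsUnit.of_mul_eq_one
      (⟨(x : E)⁻¹, (padicVal_le_one_iff p).1 (by rw [map_inv₀, h, inv_one])⟩ : ringOfIntegers p E)
      (Subtype.ext (mul_inv_cancel₀ h0))

theorem mem_primeIdeal_iff {x : ringOfIntegers p E} :
    x ∈ primeIdeal p E ↔ padicVal p E x < 1 := by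
  rw [primeIdeal, Ideal.mem_jacobson_bot]
  have hx := (padicVal_le_one_iff p).2 x.2
  constructor
  · intro h
    refine lt_of_le_of_ne hx fun h1 => ?_
    obtain ⟨u, rfl⟩ := (isUnit_ringOfIntegers_iff p).2 h1
    have := h (-(u⁻¹ : (ringOfIntegers p E)ˣ))
    simp at this
  · intro h y
    rw [isUnit_ringOfIntegers_iff]
    push_cast
    rw [add_comm]
    refine Valuation.map_one_add_of_lt _ ?_
    rw [map_mul]
    exact (mul_le_of_le_one_right zero_le ((padicVal_le_one_iff p).2 y.2)).trans_lt h

section Uniformizer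

variable {p} {ϖ : E} (h0 : 0 < padicVal p E ϖ) (h1 : padicVal p E ϖ < 1)
  (hϖ : ∀ x : E, x ≠ 0 → ∃ n : ℤ, padicVal p E x = padicVal p E ϖ ^ n)
include h0 h1 hϖ

theorem padicVal_le_of_lt_one {x : E} (hx : padicVal p E x < 1) :
    padicVal p E x ≤ padicVal p E ϖ := by
  by_cases hx0 : x = 0
  · simp [hx0]
  obtain ⟨n, hn⟩ := hϖ x hx0
  rw [hn, zpow_lt_one_iff_right_of_lt_one₀ h0 h1] at hx
  rw [hn]
  calc _ ≤ padicVal p E ϖ ^ (1 : ℤ) := zpow_le_zpow_right_of_le_one₀ h0 h1.le (by omega)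
    _ = _ := zpow_one _

theorem mem_primeIdeal_pow_iff (n : ℕ) {x : ringOfIntegers p E} :
    x ∈ primeIdeal p E ^ n ↔ padicVal p E x ≤ padicVal p E ϖ ^ n := by
  let P : ringOfIntegers p E := ⟨ϖ, (padicVal_le_one_iff p).1 h1.le⟩
  have hdvd : ∀ (m : ℕ) (y : ringOfIntegers p E),
      P ^ m ∣ y ↔ padicVal p E y ≤ padicVal p E ϖ ^ m := by
    intro m y
    constructor
    · rintro ⟨z, rfl⟩
      push_cast
      rw [map_mul, map_pow]
      exact mul_le_of_le_one_right zero_le ((padicVal_le_one_iff p).2 z.2)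
    · intro h
      have hne : ϖ ^ m ≠ 0 := pow_ne_zero _ ((Valuation.pos_iff _).1 h0)
      refine ⟨⟨y / ϖ ^ m, (padicVal_le_one_iff p).1 ?_⟩, Subtype.ext ?_⟩
      · rw [map_div₀, map_pow]
        exact div_le_one_of_le₀ h zero_le
      · push_cast
        change (y : E) = ϖ ^ m * (y / ϖ ^ m)
        field_simp
  have hspan : primeIdeal p E = Ideal.span {P} := by
    ext y
    rw [mem_primeIdeal_iff, Ideal.mem_span_singleton]
    have := hdvd 1 y
    rw [pow_one, pow_one] at this
    rw [this]
    exact ⟨padicVal_le_of_lt_one h0 h1 hϖ, fun h => h.trans_lt h1⟩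
  rw [hspan, Ideal.span_singleton_pow, Ideal.mem_span_singleton, hdvd]

theorem mem_ramificationGroup_iff {i : ℤ} {σ : E ≃ₐ[K] E} :
    σ ∈ ramificationGroup p K E i ↔
      ∀ x : E, padicVal p E x ≤ 1 →
        padicVal p E (σ x - x) ≤ padicVal p E ϖ ^ (i + 1).toNat := by
  have hmem : σ ∈ ramificationGroup p K E i ↔
      ∀ x : ringOfIntegers p E, σ • x - x ∈ primeIdeal p E ^ (i + 1).toNat := Iff.rfl
  have hcoe : ∀ x : ringOfIntegers p E, ((σ • x - x : ringOfIntegers p E) : E) = σ x - x :=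
    fun x => rfl
  simp only [hmem, mem_primeIdeal_pow_iff h0 h1 hϖ, hcoe]
  exact ⟨fun h x hx => h ⟨x, (padicVal_le_one_iff p).1 hx⟩,
    fun h x => h x ((padicVal_le_one_iff p).2 x.2)⟩

variable {σ : E ≃ₐ[K] E}

/-- If `σ` lies in a ramification group, it lies in the next one as soon as it moves the uniformizer
little enough. -/
theorem padicVal_sub_le_of_uniformizer {n : ℕ} (hn : 1 ≤ n)
    (hσ : ∀ x : E, padicVal p E x ≤ 1 → padicVal p E (σ x - x) ≤ padicVal p E ϖ ^ n)
    (hσϖ : padicVal p E (σ ϖ - ϖ) ≤ padicVal p E ϖ ^ (n + 1)) (x : E)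
    (hx : padicVal p E x ≤ 1) : padicVal p E (σ x - x) ≤ padicVal p E ϖ ^ (n + 1) := by
  set v := padicVal p E with hv
  have hϖ0 : ϖ ≠ 0 := (Valuation.pos_iff _).1 h0
  have hlt : ∀ d : E, v d < 1 → v (σ d - d) ≤ v ϖ ^ (n + 1) := by
    intro d hd
    set y := d / ϖ with hy
    have hd' : d = y * ϖ := by rw [hy]; field_simp
    have hvy : v y ≤ 1 := by
      rw [hy, map_div₀]
      exact div_le_one_of_le₀ (padicVal_le_of_lt_one h0 h1 hϖ hd) zero_le
    have e : σ d - d = σ y * (σ ϖ - ϖ) + (σ y - y) * ϖ := by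
      rw [hd', map_mul]; ring
    rw [e]
    refine v.map_add_le ?_ ?_
    · rw [map_mul, hv, padicVal_algEquiv]
      exact (mul_le_of_le_one_left zero_le hvy).trans hσϖ
    · rw [map_mul, pow_succ]
      exact mul_le_mul_left (hσ y hvy) _
  rcases hx.lt_or_eq with hx1 | hx1
  · exact hlt x hx1
  obtain ⟨q, hq1, hq⟩ := exists_natCast_pow_sub p (F := E)
  have hx0 : x ≠ 0 := fun h => by simp [h] at hx1
  set w := (σ x - x) / x with hw
  have hvw : v w ≤ v ϖ ^ n := by
    rw [hw, map_div₀, hx1, div_one]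
    exact hσ x hx
  have hvw1 : v w ≤ 1 := hvw.trans (pow_le_one₀ zero_le h1.le)
  have hσx : σ x = x * (1 + w) := by rw [hw]; field_simp; ring
  -- For a unit `x`, write `x = x ^ q - d` with `d` in the maximal ideal, where the bound is known.
  -- The displacement of `x ^ q` gains a factor, since both `q w` and `w ^ 2` are smaller than `w`
  -- by at least `v ϖ`.
  have e : σ x - x = x ^ q * (((1 + w) ^ q - 1 - q * w) + q * w) - (σ (x ^ q - x) - (x ^ q - x)) := by
    rw [map_sub, map_pow, hσx, mul_pow]; ring
  rw [e]
  refine v.map_sub_le ?_ (hlt _ (hq x hx))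
  rw [map_mul, map_pow, hx1, one_pow, one_mul]
  refine v.map_add_le ((map_one_add_pow_sub_le v hvw1 q).trans ?_) ?_
  · calc v w ^ 2 ≤ (v ϖ ^ n) ^ 2 := by gcongr
      _ = v ϖ ^ (n * 2) := by rw [pow_mul]
      _ ≤ _ := pow_le_pow_of_le_one zero_le h1.le (by omega)
  · rw [map_mul, pow_succ, mul_comm]
    exact mul_le_mul' hvw (padicVal_le_of_lt_one h0 h1 hϖ hq1)

/-- An element of order `p` of the inertia group lies in the wild inertia group. -/
theorem padicVal_sub_uniformizer_le_of_pow_eq_one (hσp : σ ^ p = 1)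
    (hσ : ∀ x : E, padicVal p E x ≤ 1 → padicVal p E (σ x - x) < 1) :
    padicVal p E (σ ϖ - ϖ) ≤ padicVal p E ϖ ^ 2 := by
  have hp : p.Prime := Fact.out
  set v := padicVal p E with hv
  have hϖ0 : ϖ ≠ 0 := (Valuation.pos_iff _).1 h0
  set θ := σ ϖ / ϖ with hθ
  have hσϖ : σ ϖ = ϖ * θ := by rw [hθ]; field_simp
  have hvσ : ∀ x, v (σ x) = v x := padicVal_algEquiv p σ
  have hvθ : v θ = 1 := by rw [hθ, map_div₀, hvσ, div_self h0.ne']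
  -- As `σ` is trivial on the residue field, `σ ^ n ϖ / ϖ ≡ θ ^ n`. With `n = p` this gives `θ ^ p ≡
  -- 1`, hence `θ ≡ 1` in residue characteristic `p`.
  have hpow : ∀ n : ℕ, v ((σ ^ n) ϖ / ϖ - θ ^ n) < 1 := by
    intro n
    induction n with
    | zero => simp [hϖ0]
    | succ n ih =>
      set z := (σ ^ n) ϖ / ϖ with hz
      have hvz : v z ≤ 1 := by
        rw [show z = (z - θ ^ n) + θ ^ n by ring]
        exact v.map_add_le ih.le (by rw [map_pow, hvθ, one_pow])
      have e : (σ ^ (n + 1)) ϖ / ϖ - θ ^ (n + 1) = (σ z - z) * θ + (z - θ ^ n) * θ := by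
        have : (σ ^ (n + 1)) ϖ = σ z * σ ϖ := by
          rw [← map_mul, hz, div_mul_cancel₀ _ hϖ0, pow_succ']; rfl
        rw [this, hσϖ, pow_succ]
        field_simp
        ring
      rw [e]
      refine v.map_add_lt ?_ ?_
      · rw [map_mul, hvθ, mul_one]; exact hσ z hvz
      · rw [map_mul, hvθ, mul_one]; exact ih
  have h2 := hpow p
  rw [hσp, AlgEquiv.one_apply, div_self hϖ0] at h2
  have h3 : v ((θ - 1) ^ p) < 1 := by
    have h4 := map_add_pow_prime_sub_le v hp (x := θ - 1) (y := 1) (M := 1)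
      (v.map_sub_le hvθ.le v.map_one.le) v.map_one.le
    rw [one_pow, one_pow, mul_one, sub_add_cancel] at h4
    rw [show (θ - 1) ^ p = -((1 - θ ^ p)) - (θ ^ p - ((θ - 1) ^ p + 1)) by ring]
    refine v.map_sub_lt ?_ (h4.trans_lt (padicVal_prime_lt_one p))
    rwa [v.map_neg]
  rw [map_pow, pow_lt_one_iff_of_nonneg zero_le hp.ne_zero] at h3
  rw [show σ ϖ - ϖ = ϖ * (θ - 1) by rw [hσϖ]; ring, map_mul, pow_two]
  exact mul_le_mul_right (padicVal_le_of_lt_one h0 h1 hϖ h3) _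

omit hϖ [Algebra ℚ_[p] K] [IsScalarTower ℚ_[p] K E] in
/-- The displacement by `σ` of an element whose valuation is prime to `p`. -/
theorem padicVal_div_sub_one_eq {t : ℕ} (ht : 1 ≤ t)
    (hσ : ∀ x : E, padicVal p E x ≤ 1 → padicVal p E (σ x - x) ≤ padicVal p E ϖ ^ (t + 1))
    (hσϖ : padicVal p E (σ ϖ - ϖ) = padicVal p E ϖ ^ (t + 1)) {m : ℕ} (hm : ¬ p ∣ m) {x : E}
    (hx : padicVal p E x = padicVal p E ϖ ^ m) :
    padicVal p E (σ x / x - 1) = padicVal p E ϖ ^ t := by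
  set v := padicVal p E with hv
  have hϖ0 : ϖ ≠ 0 := (Valuation.pos_iff _).1 h0
  -- The unit `u` moves only to order `t + 1`, while `ϖ ^ m` contributes `(1 + w) ^ m - 1`, of the
  -- same order `t` as `w` because `m` is prime to `p`.
  set u := x / ϖ ^ m with hu
  have hvu : v u = 1 := by rw [hu, map_div₀, hx, map_pow, div_self (pow_pos h0 _).ne']
  have hu0 : u ≠ 0 := fun h => by simp [h] at hvu
  set w := (σ ϖ - ϖ) / ϖ with hw
  set ε := (σ u - u) / u with hε
  have hvw : v w = v ϖ ^ t := by
    rw [hw, map_div₀, hσϖ, pow_succ, mul_div_assoc, div_self h0.ne', mul_one]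
  have hvε : v ε ≤ v ϖ ^ (t + 1) := by
    rw [hε, map_div₀, hvu, div_one]
    exact hσ u hvu.le
  have hw1 : v w < 1 := by rw [hvw]; exact pow_lt_one₀ zero_le h1 (by omega)
  have e : σ x / x - 1 = ((1 + w) ^ m - 1) + (1 + w) ^ m * ε := by
    have hx' : x = u * ϖ ^ m := by rw [hu]; field_simp
    have e1 : σ ϖ = ϖ * (1 + w) := by rw [hw]; field_simp; ring
    have e2 : σ u = u * (1 + ε) := by rw [hε]; field_simp; ring
    rw [hx', map_mul, map_pow, e1, e2, mul_pow]
    field_simp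
    ring
  have h2 : v ((1 + w) ^ m - 1) = v ϖ ^ t := by
    rw [map_one_add_pow_sub_one v hw1 (padicVal_natCast_eq_one p hm), hvw]
  rw [e, v.map_add_eq_of_lt_left, h2]
  rw [h2, map_mul, map_pow, v.map_one_add_of_lt hw1, one_pow, one_mul]
  refine hvε.trans_lt (pow_lt_pow_right_of_lt_one₀ h0 h1 (by omega))

end Uniformizer

end Ramification

/-! ### From `a = 0` to a `p`-th root of a uniformizer -/

section MaximallyRamifiedCase

variable {p : ℕ} [Fact p.Prime] {K L E : Type*} [Field K] [Field L] [Algebra ℚ_[p] L]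
  [Algebra K L] [Field E] [Algebra ℚ_[p] E] [Algebra K E] [Algebra L E] [IsScalarTower ℚ_[p] L E]
  [IsScalarTower K L E] [Algebra.IsAlgebraic ℚ_[p] E] [Algebra.IsAlgebraic ℚ_[p] L]

theorem padicVal_algebraMap (x : L) : padicVal p E (algebraMap L E x) = padicVal p L x :=
  padicVal_map p (IsScalarTower.toAlgHom ℚ_[p] L E) x

/-- If a ramification jump is divisible by `p`, then every uniformizer of `L` is close to a `p`-th
root of a uniformizer of `K`. -/
theorem exists_pow_prime_eq_mul_one_add (hdeg : Module.finrank K L = p) {ϖ : E}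
    (h0 : 0 < padicVal p E ϖ) (h1 : padicVal p E ϖ < 1) {π : L} {R : ℕ} (hR : ¬ p ∣ R)
    (hπ : padicVal p L π = padicVal p E ϖ ^ R)
    (hK : ∀ c : K, c ≠ 0 →
      ∃ n : ℤ, padicVal p L (algebraMap K L c) = padicVal p L π ^ (p * n))
    (σ : E ≃ₐ[K] E) {T : ℕ} (hT : p ∣ T) (hT1 : 1 ≤ T)
    (hw : padicVal p E (σ (algebraMap L E π) / algebraMap L E π - 1) = padicVal p E ϖ ^ T) :
    ∃ (a : K) (y : L), π ^ p = algebraMap K L a * (1 + y) ∧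
      padicVal p L y ≤ padicVal p L p * padicVal p L π := by
  have hp : p.Prime := Fact.out
  have hR0 : R ≠ 0 := by rintro rfl; simp at hR
  set v := padicVal p L with hv
  set V := padicVal p E with hV
  have hVv : ∀ x : L, V (algebraMap L E x) = v x := padicVal_algebraMap
  have hπ0 : 0 < v π := hπ ▸ pow_pos h0 _
  have hπ1 : v π < 1 := hπ ▸ pow_lt_one₀ zero_le h1 hR0
  set P := algebraMap L E π with hP
  have hP0 : P ≠ 0 := by
    rw [← Valuation.pos_iff V, hP, hVv]; exact hπ0
  set w := σ P / P - 1 with hwdef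
  have hσP : σ P = P * (1 + w) := by rw [hwdef]; field_simp; ring
  have hw1 : V w < 1 := hw ▸ pow_lt_one₀ zero_le h1 (by omega)
  have hw0 : 0 < V w := hw ▸ pow_pos h0 _
  obtain ⟨c, hc⟩ := exists_eq_powSum v hπ0 hπ1 hK hp.pos hdeg (π ^ p)
  set f : Fin p → L := fun i => c i • π ^ (i : ℕ) with hf
  -- The difference between the expansion of `P ^ p` and its image under `σ`, which fixes the
  -- coefficients; the term `i = 0` drops out.
  have hsum : P ^ p * ((1 + w) ^ p - 1) =
      ∑ i, algebraMap L E (f i) * ((1 + w) ^ (i : ℕ) - 1) := by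
    have e1 : P ^ p = ∑ i, algebraMap L E (f i) := by rw [hP, ← map_pow, hc, map_sum]
    have e2 : P ^ p * (1 + w) ^ p = ∑ i, algebraMap L E (f i) * (1 + w) ^ (i : ℕ) := by
      rw [← mul_pow, ← hσP, ← map_pow, e1, map_sum]
      refine Finset.sum_congr rfl fun i _ => ?_
      rw [hf]
      simp only [Algebra.smul_def, map_mul, map_pow]
      rw [← IsScalarTower.algebraMap_apply, AlgEquiv.commutes, ← hP, hσP, mul_pow, mul_assoc]
    rw [mul_sub, e2, mul_one, e1, ← Finset.sum_sub_distrib]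
    exact Finset.sum_congr rfl fun i _ => by ring
  have hvT : ∀ i : Fin p, (i : ℕ) ≠ 0 →
      V (algebraMap L E (f i) * ((1 + w) ^ (i : ℕ) - 1)) = v (f i) * V w := by
    intro i hi
    rw [map_mul, hVv, map_one_add_pow_sub_one V hw1 (padicVal_natCast_eq_one p
      (Nat.not_dvd_of_pos_of_lt (by omega) i.2))]
  have hne : ∀ i : Fin p, algebraMap L E (f i) * ((1 + w) ^ (i : ℕ) - 1) ≠ 0 →
      (i : ℕ) ≠ 0 := by
    rintro i hi h
    simp [h] at hi
  have hsup := map_sum_eq_sup V Finset.univ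
    (fun i => algebraMap L E (f i) * ((1 + w) ^ (i : ℕ) - 1)) (by
      intro i _ j _ hij h
      have hj : algebraMap L E (f j) * ((1 + w) ^ (j : ℕ) - 1) ≠ 0 := by
        rwa [← Valuation.ne_zero_iff V, ← hij, Valuation.ne_zero_iff V]
      rw [hvT i (hne i h), hvT j (hne j hj)] at hij
      refine eq_of_map_smul_pow_eq v hπ0 hπ1 hK (mul_right_cancel₀ hw0.ne' hij) ?_
      intro h'
      exact h (by rw [hf]; simp only [h', map_zero, zero_mul]))
  rw [← hsum] at hsup
  have hbd : V (P ^ p * ((1 + w) ^ p - 1)) ≤ v p * v π ^ p * V w := by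
    have hZ := map_one_add_pow_prime_sub_sub V hp hw1
    have hVp : V (p : E) = v p := by rw [← hVv, map_natCast (algebraMap L E)]
    rw [hVp] at hZ
    rw [map_mul, map_pow, hP, hVv, mul_comm (v (p : L)), mul_assoc]
    refine mul_le_mul_right ?_ _
    rw [show (1 + w) ^ p - 1 = ((1 + w) ^ p - 1 - w ^ p) + w ^ p by ring]
    refine V.map_add_le hZ.le ?_
    -- If `w ^ p` dominated, the left side of `hsum` would have exponent `p R + p T`, against `R (p
    -- n + i) + T` for some `0 < i < p` on the right. As `p ∣ T`, this forces `p ∣ R i`, which is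
    -- impossible.
    by_contra! hlt
    have h2 : V ((1 + w) ^ p - 1) = V w ^ p := by
      rw [show (1 + w) ^ p - 1 = ((1 + w) ^ p - 1 - w ^ p) + w ^ p by ring,
        V.map_add_eq_of_lt_right (hZ ▸ hlt), map_pow]
    have : Nonempty (Fin p) := ⟨⟨0, hp.pos⟩⟩
    obtain ⟨i, -, hi⟩ := Finset.exists_mem_eq_sup Finset.univ Finset.univ_nonempty
      fun i : Fin p => V (algebraMap L E (f i) * ((1 + w) ^ (i : ℕ) - 1))
    rw [hi, map_mul, h2, map_pow, hP, hVv] at hsup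
    have hi0 := hne i (by
      rw [← Valuation.ne_zero_iff V, ← hsup]
      exact (mul_pos (pow_pos hπ0 _) (pow_pos hw0 _)).ne')
    rw [hvT i hi0] at hsup
    have hci : c i ≠ 0 := by
      intro h
      have : f i = 0 := by simp [hf, h]
      rw [this, map_zero, zero_mul] at hsup
      exact (mul_pos (pow_pos hπ0 _) (pow_pos hw0 _)).ne' hsup
    obtain ⟨n, hn⟩ := exists_map_smul_pow_eq v hπ0 hK hci i
    have hn' : v (f i) = v π ^ (p * n + i) := hn
    rw [hn', hπ, hw, ← pow_mul, ← pow_mul, ← zpow_natCast, ← zpow_natCast, ← zpow_natCast,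
      ← zpow_natCast, ← zpow_mul, ← zpow_add₀ h0.ne', ← zpow_add₀ h0.ne'] at hsup
    have h3 := zpow_right_injective₀ h0 h1.ne hsup
    obtain ⟨s, rfl⟩ := hT
    push_cast at h3
    have h4 : (p : ℤ) ∣ ((R * i : ℕ) : ℤ) := by
      refine ⟨R + p * s - R * n - s, ?_⟩
      push_cast
      linear_combination -h3
    rcases hp.dvd_mul.1 (Int.natCast_dvd_natCast.1 h4) with h5 | h5
    · exact hR h5
    · exact Nat.not_dvd_of_pos_of_lt (by omega) i.2 h5
  have hfi : ∀ i : Fin p, (i : ℕ) ≠ 0 → v (f i) ≤ v p * v π ^ (p + 1) := by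
    intro i hi
    have h2 : v (f i) ≤ v p * v π ^ p := by
      have h3 := Finset.le_sup (f := fun i : Fin p =>
        V (algebraMap L E (f i) * ((1 + w) ^ (i : ℕ) - 1))) (Finset.mem_univ i)
      rw [← hsup] at h3
      have h4 := h3.trans hbd
      rw [hvT i hi] at h4
      exact le_of_mul_le_mul_right h4 hw0
    by_cases hci : c i = 0
    · simp [hf, hci]
    obtain ⟨n, hn⟩ := exists_map_smul_pow_eq v hπ0 hK hci i
    have hn' : v (f i) = v π ^ (p * n + i) := hn
    have hpL : (p : K) ≠ 0 := by
      intro h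
      have := padicVal_prime_pos p (F := L)
      rw [Valuation.pos_iff] at this
      exact this (by rw [← map_natCast (algebraMap K L), h, map_zero])
    obtain ⟨k, hk⟩ := hK p hpL
    rw [map_natCast] at hk
    rw [hn', hk, ← zpow_natCast, ← zpow_add₀ hπ0.ne'] at h2 ⊢
    rw [zpow_le_zpow_iff_right_of_lt_one₀ hπ0 hπ1] at h2 ⊢
    have hlt := i.2
    push_cast
    -- The bound `h2` cannot be an equality, since its right side has exponent divisible by `p` and
    -- `p ∤ i`; this gains one more factor `v π`.
    by_contra! h3
    have h4 : (i : ℤ) = p * (k + 1 - n) := by linarith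
    have h5 : (p : ℤ) ∣ (i : ℕ) := ⟨_, h4⟩
    exact Nat.not_dvd_of_pos_of_lt (by omega) i.2 (Int.natCast_dvd_natCast.1 h5)
  set S := ∑ i ∈ Finset.univ.erase (⟨0, hp.pos⟩ : Fin p), f i with hS
  have hvS : v S ≤ v p * v π ^ (p + 1) := v.map_sum_le fun i hi => hfi i fun h =>
    (Finset.mem_erase.1 hi).1 (Fin.ext h)
  have hdec : π ^ p = algebraMap K L (c ⟨0, hp.pos⟩) + S := by
    rw [hc, ← Finset.add_sum_erase _ _ (Finset.mem_univ (⟨0, hp.pos⟩ : Fin p))]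
    simp [hS, hf, Algebra.smul_def]
  set a := c ⟨0, hp.pos⟩
  have hva : v (algebraMap K L a) = v π ^ p := by
    rw [show algebraMap K L a = π ^ p - S by rw [hdec]; ring, v.map_sub_eq_of_lt_left, map_pow]
    rw [map_pow]
    refine hvS.trans_lt ((mul_le_of_le_one_left zero_le (valuation_natCast_le_one v p)).trans_lt ?_)
    exact pow_lt_pow_right_of_lt_one₀ hπ0 hπ1 (by omega)
  have ha0 : algebraMap K L a ≠ 0 := by
    rw [← Valuation.pos_iff v, hva]; exact pow_pos hπ0 _
  refine ⟨a, S / algebraMap K L a, ?_, ?_⟩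
  · rw [hdec]; field_simp
  · rw [map_div₀, hva]
    refine div_le_of_le_mul₀ zero_le zero_le (hvS.trans_eq ?_)
    rw [pow_succ]; ring

end MaximallyRamifiedCase

section MaximallyRamifiedCase

variable {p : ℕ} [Fact p.Prime] {K L E : Type*} [Field K] [Field L] [Algebra ℚ_[p] L]
  [Algebra K L] [Field E] [Algebra ℚ_[p] E] [Algebra K E] [Algebra L E] [IsScalarTower ℚ_[p] L E]
  [IsScalarTower K L E]

/-- The value of `a` is `v α ^ p`, and all values of `K` are powers of it, so `a` is irreducible.
The powers of `α` span `L` by their distinct valuations. -/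
theorem isGeneratingRoot_of_pow_eq [Algebra ℚ_[p] K] [IsScalarTower ℚ_[p] K L]
    [FiniteDimensional ℚ_[p] K] [FiniteDimensional ℚ_[p] L] (hdeg : Module.finrank K L = p)
    {α : L} {a : K} (ha : α ^ p = algebraMap K L a) (h0 : 0 < padicVal p L α)
    (h1 : padicVal p L α < 1)
    (hK : ∀ c : K, c ≠ 0 →
      ∃ n : ℤ, padicVal p L (algebraMap K L c) = padicVal p L α ^ (p * n)) :
    IsGeneratingRoot p K α := by
  have hp : p.Prime := Fact.out
  have hva : padicVal p K a = padicVal p L α ^ p := by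
    rw [← padicVal_algebraMap (E := L), ← ha, map_pow]
  have hval : ∀ x : ringOfIntegers p K, x ≠ 0 →
      ∃ n : ℕ, padicVal p K x = padicVal p L α ^ (p * n) := by
    intro x hx
    obtain ⟨n, hn⟩ := hK x (fun h => hx (Subtype.ext h))
    rw [padicVal_algebraMap] at hn
    have h2 := (padicVal_le_one_iff p).2 x.2
    rw [hn, zpow_le_one_iff_right_of_lt_one₀ h0 h1] at h2
    have h3 : 0 ≤ n := nonneg_of_mul_nonneg_right h2 (by exact_mod_cast hp.pos)
    lift n to ℕ using h3
    exact ⟨n, by rw [hn]; exact_mod_cast rfl⟩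
  have hinj : ∀ m n : ℕ, padicVal p L α ^ m = padicVal p L α ^ n → m = n := fun m n h =>
    pow_right_injective₀ h0 h1.ne h
  refine ⟨⟨⟨a, (padicVal_le_one_iff p).1 (hva ▸ pow_le_one₀ zero_le h1.le)⟩, ?_, ha⟩, ?_⟩
  · rw [irreducible_iff]
    constructor
    · rw [isUnit_ringOfIntegers_iff, hva]
      exact (pow_lt_one₀ zero_le h1 hp.ne_zero).ne
    · intro x y hxy
      have hxy' : a = x * y := congrArg Subtype.val hxy
      have ha0 : a ≠ 0 := by
        rw [← Valuation.pos_iff (padicVal p K), hva]; exact pow_pos h0 _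
      have hx0 : x ≠ 0 := by rintro rfl; exact ha0 (by simpa using hxy')
      have hy0 : y ≠ 0 := by rintro rfl; exact ha0 (by simpa using hxy')
      obtain ⟨n, hn⟩ := hval x hx0
      obtain ⟨m, hm⟩ := hval y hy0
      rw [hxy', map_mul, hn, hm, ← pow_add] at hva
      have h2 := hinj _ _ hva
      rw [← mul_add, Nat.mul_eq_left hp.ne_zero] at h2
      rw [isUnit_ringOfIntegers_iff, isUnit_ringOfIntegers_iff, hn, hm]
      rcases (by omega : n = 0 ∨ m = 0) with rfl | rfl
      · left; simp
      · right; simp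
  · rw [eq_top_iff]
    intro x _
    obtain ⟨c, hc⟩ := exists_eq_powSum (padicVal p L) h0 h1 hK hp.pos hdeg x
    rw [hc]
    exact sum_mem fun i _ => IntermediateField.smul_mem _
      (pow_mem (IntermediateField.mem_adjoin_simple_self K α) _)

variable [Algebra ℚ_[p] K] [IsScalarTower ℚ_[p] K L] [IsScalarTower ℚ_[p] K E]
  [FiniteDimensional ℚ_[p] K] [IsNormalClosure K L E]

theorem exists_isGeneratingRoot_of_isMaximallyRamified (hdeg : Module.finrank K L = p)
    (h : IsMaximallyRamified p K L E) : ∃ α : L, IsGeneratingRoot p K α := by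
  have hp : p.Prime := Fact.out
  obtain ⟨t, r, c, ℓ, ⟨hcard, hbot⟩, -, -, hℓ, hℓp⟩ := h
  have : CharZero K := charZero_of_injective_algebraMap (algebraMap ℚ_[p] K).injective
  have : FiniteDimensional K L := Module.finite_of_finrank_pos (hdeg ▸ hp.pos)
  have : FiniteDimensional K E := finiteDimensional_of_isNormalClosure K L E
  have : FiniteDimensional L E := FiniteDimensional.right K L E
  have : FiniteDimensional ℚ_[p] L := FiniteDimensional.trans ℚ_[p] K L
  have : FiniteDimensional ℚ_[p] E := FiniteDimensional.trans ℚ_[p] K E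
  have := isGalois_of_isNormalClosure K L E hp hdeg
  have : IsGalois L E := IsGalois.tower_top_of_isGalois K L E
  have hpt : (p : ℤ) ∣ t := by
    have h1 : (p : ℤ) ∣ r * ℓ := (Int.dvd_of_emod_eq_zero hℓp).mul_left r
    rw [hℓ] at h1
    exact (Int.dvd_add_right ⟨c * (r - 1), by ring⟩).1 h1
  obtain ⟨ϖ, h0, h1, hϖ⟩ := exists_uniformizer p (F := E)
  have ht : 0 ≤ t := by
    -- The value `t = -1` is not divisible by `p`. For `t ≤ -2` the exponents of both `G_t` and
    -- `G_{t+1}` truncate to `0`, so the groups coincide, contrary to the jump.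
    by_contra! htneg
    have h2 : t ≠ -1 := by
      rintro rfl
      have := hp.one_lt
      have h3 := Int.le_of_dvd one_pos ((dvd_neg.1 hpt))
      omega
    have h3 : ramificationGroup p K E t = ramificationGroup p K E (t + 1) := by
      rw [ramificationGroup, ramificationGroup]
      rw [show (t + 1).toNat = (t + 1 + 1).toNat by omega]
    rw [h3, hbot, Subgroup.card_bot] at hcard
    exact hp.one_lt.ne hcard
  lift t to ℕ using ht
  obtain ⟨σ, hσt, hσ1⟩ : ∃ σ ∈ ramificationGroup p K E t, σ ≠ 1 := by
    by_contra! h2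
    rw [(Subgroup.eq_bot_iff_forall _).2 h2, Subgroup.card_bot] at hcard
    exact hp.one_lt.ne hcard
  have hσp : σ ^ p = 1 := by
    have h2 := pow_card_eq_one' (x := (⟨σ, hσt⟩ : ramificationGroup p K E t))
    rw [hcard] at h2
    exact congrArg Subtype.val h2
  have hσ : ∀ x : E, padicVal p E x ≤ 1 →
      padicVal p E (σ x - x) ≤ padicVal p E ϖ ^ (t + 1) := by
    have h2 := (mem_ramificationGroup_iff h0 h1 hϖ).1 hσt
    exact fun x hx => h2 x hx
  have hσne : ¬ padicVal p E (σ ϖ - ϖ) ≤ padicVal p E ϖ ^ (t + 1 + 1) := by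
    intro h2
    refine hσ1 ?_
    rw [← Subgroup.mem_bot, ← hbot, mem_ramificationGroup_iff h0 h1 hϖ]
    exact padicVal_sub_le_of_uniformizer h0 h1 hϖ (by omega) hσ h2
  have hσϖ : padicVal p E (σ ϖ - ϖ) = padicVal p E ϖ ^ (t + 1) := by
    have h2 : σ ϖ - ϖ ≠ 0 := fun h3 => hσne (by simp [h3])
    obtain ⟨k, hk⟩ := hϖ _ h2
    have h3 := hσ ϖ h1.le
    rw [hk, ← zpow_natCast, zpow_le_zpow_iff_right_of_lt_one₀ h0 h1] at h3 hσne
    rw [hk, ← zpow_natCast]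
    congr 1
    push_cast at *
    omega
  have ht1 : 1 ≤ t := by
    by_contra! h2
    obtain rfl : t = 0 := by omega
    refine hσne (padicVal_sub_uniformizer_le_of_pow_eq_one h0 h1 hϖ hσp fun x hx => ?_)
    exact (hσ x hx).trans_lt (by simpa using h1)
  obtain ⟨π, hπ0, hπ1, hπ⟩ := exists_uniformizer p (F := L)
  have hππ : π ≠ 0 := (Valuation.pos_iff _).1 hπ0
  obtain ⟨R, hR⟩ : ∃ R : ℕ, padicVal p L π = padicVal p E ϖ ^ R := by
    obtain ⟨R, hR⟩ := hϖ (algebraMap L E π) (by simpa using hππ)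
    rw [padicVal_algebraMap] at hR
    have h2 := hπ1.le
    rw [hR, zpow_le_one_iff_right_of_lt_one₀ h0 h1] at h2
    lift R to ℕ using h2
    exact ⟨R, by rw [hR, zpow_natCast]⟩
  -- The norm of `ϖ` has value `v ϖ ^ [E : L]` and lies in `L`, so `R` divides `[E : L]`, which is
  -- prime to `p`.
  have hpR : ¬ p ∣ R := by
    intro h2
    have h3 : padicVal p L (Algebra.norm L ϖ) = padicVal p E ϖ ^ Module.finrank L E := by
      rw [← padicVal_algebraMap (E := E), Algebra.norm_eq_prod_automorphisms, map_prod]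
      simp only [padicVal_algEquiv]
      rw [Finset.prod_const, Finset.card_univ, ← Nat.card_eq_fintype_card,
        IsGalois.card_aut_eq_finrank]
    obtain ⟨n, hn⟩ := hπ (Algebra.norm L ϖ)
      (Algebra.norm_ne_zero_iff.2 ((Valuation.pos_iff _).1 h0))
    rw [h3, hR, ← zpow_natCast, ← zpow_natCast, ← zpow_mul] at hn
    have h4 := zpow_right_injective₀ h0 h1.ne hn
    refine not_dvd_finrank_normalClosure K L E hp hdeg (Int.natCast_dvd_natCast.1 ?_)
    rw [h4]
    exact (Int.natCast_dvd_natCast.2 h2).mul_right n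
  have hdisp := fun (m : ℕ) (hm : ¬ p ∣ m) (x : E) =>
    padicVal_div_sub_one_eq h0 h1 ht1 hσ hσϖ hm (x := x)
  -- An element of order prime to `p` is moved by `σ`, whereas `c` is fixed.
  have hKnat : ∀ c : K, c ≠ 0 → ∀ m : ℕ,
      padicVal p E (algebraMap K E c) = padicVal p E ϖ ^ m → p ∣ m := by
    intro c hc m hm
    by_contra h2
    have h3 := hdisp m h2 _ hm
    rw [AlgEquiv.commutes, div_self (by simpa using hc), sub_self, map_zero] at h3
    exact (pow_pos h0 _).ne h3
  have hK : ∀ c : K, c ≠ 0 →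
      ∃ n : ℤ, padicVal p L (algebraMap K L c) = padicVal p L π ^ (p * n) := by
    intro c hc
    obtain ⟨k, hk⟩ := hπ (algebraMap K L c) (by simpa using hc)
    have hkE : padicVal p E (algebraMap K E c) = padicVal p E ϖ ^ (R * k) := by
      rw [IsScalarTower.algebraMap_apply K L E, padicVal_algebraMap, hk, hR, zpow_mul,
        zpow_natCast]
    have h2 : (p : ℤ) ∣ R * k := by
      rcases Int.eq_nat_or_neg (R * k : ℤ) with ⟨m, hm | hm⟩
      · rw [hm] at hkE ⊢
        exact Int.natCast_dvd_natCast.2 (hKnat c hc m (by rw [hkE, zpow_natCast]))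
      · rw [hm] at hkE ⊢
        refine (Int.natCast_dvd_natCast.2 (hKnat c⁻¹ (inv_ne_zero hc) m ?_)).neg_right
        rw [map_inv₀, map_inv₀, hkE, zpow_neg, inv_inv, zpow_natCast]
    obtain ⟨n, rfl⟩ := (Int.Prime.dvd_mul' hp h2).resolve_left
      (fun h3 => hpR (Int.natCast_dvd_natCast.1 h3))
    exact ⟨n, hk⟩
  obtain ⟨a, y, hay, hy⟩ := exists_pow_prime_eq_mul_one_add hdeg h0 h1 hpR hR hK σ
    (Int.natCast_dvd_natCast.1 hpt) ht1
    (hdisp R hpR _ (by rw [padicVal_algebraMap, hR]))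
  -- Approximate until the error is below `ε`; then `1 + y' = s ^ p` with a unit `s`, and `π' / s`
  -- is an exact root.
  obtain ⟨ε, hε, hroot⟩ := exists_pow_prime_eq_one_add p (F := L)
  obtain ⟨n, hn⟩ := exists_pow_lt_of_lt_one hε hπ1
  have hpL : (p : L) ≠ 0 := (Valuation.pos_iff _).1 (padicVal_prime_pos p)
  obtain ⟨π', a', y', hπ', hay', hy'⟩ := exists_approximate_root (padicVal p L) hp hpL hdeg hπ0 hπ1
    hK ⟨π, a, y, rfl, hay, hy⟩ n
  have hyn : padicVal p L y' ≤ padicVal p L π ^ (n + 1) :=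
    hy'.trans (mul_le_of_le_one_left zero_le (padicVal_natCast_le_one p p))
  obtain ⟨s, hs⟩ := hroot y'
    ((hyn.trans (pow_le_pow_of_le_one zero_le hπ1.le (by omega))).trans_lt hn)
  have hvs1 : padicVal p L (1 + y') = 1 := Valuation.map_one_add_of_lt _
    (hyn.trans_lt (pow_lt_one₀ zero_le hπ1 (by omega)))
  have hvs : padicVal p L s = 1 := by
    rw [← hs, map_pow] at hvs1
    exact (pow_eq_one_iff_of_nonneg zero_le hp.ne_zero).1 hvs1
  have hα : padicVal p L (π' / s) = padicVal p L π := by rw [map_div₀, hvs, div_one, hπ']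
  refine ⟨π' / s, isGeneratingRoot_of_pow_eq (a := a') hdeg ?_ (hα ▸ hπ0) (hα ▸ hπ1) (hα ▸ hK)⟩
  have hy0 : 1 + y' ≠ 0 := fun h2 => by simp [h2] at hvs1
  rw [div_pow, hay', hs]
  field_simp

end MaximallyRamifiedCase

/-! ### A counting lemma for permutations of order `p` -/

section FixedPoints

/-- A permutation of order dividing `p` with a fixed point on a set of at most `p` elements is
trivial. -/
theorem isFixedPt_of_card_le {p : ℕ} [Fact p.Prime] {X : Type*} [Finite X] (hX : Nat.card X ≤ p)
    {f : X → X} (hf : ∀ x, f^[p] x = x) {e : X} (he : f e = e) (x : X) : f x = x := by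
  by_contra hx
  have hmin : Function.minimalPeriod f x = p := Function.minimalPeriod_eq_prime (hf x) hx
  -- A nontrivial orbit has `p` points and misses `e`, which makes `p + 1` points in all.
  let g : Option (Fin p) → X := fun o => o.elim e fun i => f^[i] x
  have hne : ∀ i : Fin p, f^[i] x ≠ e := by
    intro i hi
    have h1 : f^[p - i] (f^[i] x) = e := by
      rw [hi]
      exact Function.iterate_fixed he _
    rw [← Function.iterate_add_apply, Nat.sub_add_cancel i.2.le, hf] at h1
    exact hx (h1 ▸ he)
  have hg : Function.Injective g := by
    rintro (_ | i) (_ | j) h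
    · rfl
    · exact absurd h.symm (hne j)
    · exact absurd h (hne i)
    · have := Function.iterate_injOn_Iio_minimalPeriod (f := f) (x := x)
        (hmin.symm ▸ i.2 : (i : ℕ) < _) (hmin.symm ▸ j.2 : (j : ℕ) < _) h
      rw [Fin.ext this]
  have := Nat.card_le_card_of_injective g hg
  simp only [Nat.card_eq_fintype_card, Fintype.card_option, Fintype.card_fin] at this
  omega

end FixedPoints

/-! ### Descent: the action of `H` through characters of its dual -/

section HopfGaloisAction

open WithConv

variable {K H L : Type*} (E : Type*) [Field K] [Field L] [Algebra K L] [Ring H] [HopfAlgebra K H]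
  [Module H L] [IsScalarTower K H L] [Field E] [Algebra K E] [Algebra L E] [IsScalarTower K L E]

variable (K H) in
/-- The map `y ↦ (h ↦ h • y)` from `L` to the convolution algebra of linear maps `H → E`. -/
def orbitMap : L →ₗ[K] WithConv (H →ₗ[K] E) where
  toFun y := toConv ((IsScalarTower.toAlgHom K L E).toLinearMap ∘ₗ (actionMap K H L).flip y)
  map_add' x y := by ext h; simp
  map_smul' c x := by
    ext h
    change algebraMap L E (actionMap K H L h (c • x)) = c • algebraMap L E (actionMap K H L h x)
    rw [map_smul]
    exact map_smul (IsScalarTower.toAlgHom K L E) c _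

/-- This is the module algebra axiom, read as a convolution product. -/
theorem orbitMap_mul (hH : IsHopfGalois K H L) (x y : L) :
    orbitMap K H E (x * y) = orbitMap K H E x * orbitMap K H E y := by
  have h1 : (actionMap K H L).flip (x * y) =
      (toConv ((actionMap K H L).flip x) * toConv ((actionMap K H L).flip y)).ofConv :=
    LinearMap.ext fun h => hH.smul_mul h x y
  have h2 := LinearMap.algHom_comp_convMul_distrib (IsScalarTower.toAlgHom K L E)
    (toConv ((actionMap K H L).flip x)) (toConv ((actionMap K H L).flip y))
  apply ofConv_injective
  change (IsScalarTower.toAlgHom K L E).toLinearMap ∘ₗ (actionMap K H L).flip (x * y) = _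
  rw [h1, h2]
  rfl

theorem orbitMap_one (hH : IsHopfGalois K H L) :
    orbitMap K H E (1 : L) = 1 := by
  apply ofConv_injective
  ext h
  change algebraMap L E (h • 1) = algebraMap K E (Coalgebra.counit (R := K) h)
  rw [hH.smul_one, ← IsScalarTower.algebraMap_apply]

variable (K H) in
/-- Extension of scalars from the dual of `H` to linear maps `H → E`. -/
def dualBaseChange : WithConv (H →ₗ[K] K) →ₐ[K] WithConv (H →ₗ[K] E) :=
  AlgHom.ofLinearMap
    { toFun := fun d => toConv (Algebra.linearMap K E ∘ₗ d.ofConv)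
      map_add' := fun x y => by ext h; simp
      map_smul' := fun c x => by
        ext h
        change algebraMap K E (c * x h) = c • algebraMap K E (x h)
        rw [map_mul, Algebra.smul_def] }
    (by ext h; simp)
    (fun x y => by
      apply ofConv_injective
      exact LinearMap.algHom_comp_convMul_distrib (Algebra.ofId K E) x y)

variable (K H) in
/-- Evaluation at `1` on the dual of `H`. -/
def dualEvalOne : WithConv (H →ₗ[K] K) →ₐ[K] K :=
  AlgHom.ofLinearMap
    (LinearMap.applyₗ (1 : H) ∘ₗ (WithConv.linearEquiv K (H →ₗ[K] K)).toLinearMap)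
    (by
      change algebraMap K K (Coalgebra.counit (R := K) (1 : H)) = 1
      simp)
    (fun x y => by
      change LinearMap.mul' K K (TensorProduct.map x.ofConv y.ofConv (Coalgebra.comul 1)) = _
      rw [Bialgebra.comul_one, Algebra.TensorProduct.one_def, TensorProduct.map_tmul,
        LinearMap.mul'_apply]
      rfl)

variable {n : Type*} [Fintype n] [DecidableEq n]

/-- The matrix of the action of `H` on `L` with respect to bases of `H` and `L`. -/
def actionMatrix (hB : Module.Basis n K H) (b : Module.Basis n K L) : Matrix n n E :=
  .of fun a k => algebraMap L E (hB a • b k)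

-- A linear relation over `L` between the rows is an element of the kernel of `j`, which is
-- injective.
omit [Algebra K E] [IsScalarTower K L E] in
theorem isUnit_actionMatrix (hH : IsHopfGalois K H L) (hB : Module.Basis n K H)
    (b : Module.Basis n K L) : IsUnit (actionMatrix E hB b) := by
  have hL : IsUnit (actionMatrix L hB b) := by
    rw [← Matrix.vecMul_injective_iff_isUnit, ← Matrix.coe_vecMulLinear,
      injective_iff_map_eq_zero]
    intro x hx
    have h1 : jMap K H L (∑ a, x a ⊗ₜ hB a) = 0 := by
      refine b.ext fun k => ?_
      rw [map_sum, LinearMap.sum_apply, LinearMap.zero_apply]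
      exact congrFun hx k
    have h2 := hH.bijective.1 (h1.trans (map_zero _).symm)
    have h3 := (Fintype.linearIndependent_iff.1 (Algebra.TensorProduct.basis L hB).linearIndependent)
      x (by simpa [TensorProduct.smul_tmul'] using h2)
    exact funext h3
  have h2 := hL.map (algebraMap L E).mapMatrix
  exact h2

variable {E}

/-- Since orbit maps span over `E`, multiplicativity of a functional need only be checked on them,
where it reduces to that of an embedding of `L`. -/
theorem exists_eq_sum_orbitMap (hH : IsHopfGalois K H L) (hB : Module.Basis n K H)
    (b : Module.Basis n K L) (f : WithConv (H →ₗ[K] E)) :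
    ∃ x : n → E, f = ∑ k, x k • orbitMap K H E (b k) := by
  obtain ⟨x, hx⟩ := Matrix.mulVec_surjective_iff_isUnit.2 (isUnit_actionMatrix E hH hB b)
    fun a => f (hB a)
  refine ⟨x, ofConv_injective (hB.ext fun a => ?_)⟩
  rw [← congrFun hx a]
  simp only [ofConv_sum, ofConv_smul, LinearMap.sum_apply, LinearMap.smul_apply]
  exact Finset.sum_congr rfl fun k _ => mul_comm _ _

/-- A point `g` of `H` over `E` that carries the embedding of `L` to another one defines a
character of the dual of `H`. -/
def characterOf (hH : IsHopfGalois K H L) (hB : Module.Basis n K H) (b : Module.Basis n K L)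
    (g : n → E) (τ : L →ₐ[K] E) (hg : ∀ y, ∑ a, g a * algebraMap L E (hB a • y) = τ y) :
    WithConv (H →ₗ[K] E) →ₐ[E] E :=
  let N : WithConv (H →ₗ[K] E) →ₗ[E] E :=
    { toFun := fun f => ∑ a, g a * f (hB a)
      map_add' := fun x y => by simp [mul_add, Finset.sum_add_distrib]
      map_smul' := fun c x => by simp [Finset.mul_sum, mul_left_comm] }
  AlgHom.ofLinearMap N
    (by
      rw [← orbitMap_one E hH]
      exact (hg 1).trans (map_one τ))
    (fun f f' => by
      obtain ⟨x, rfl⟩ := exists_eq_sum_orbitMap hH hB b f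
      obtain ⟨y, rfl⟩ := exists_eq_sum_orbitMap hH hB b f'
      have hl : ∀ z : L, N (orbitMap K H E z) = τ z := hg
      simp only [Finset.sum_mul_sum, smul_mul_smul_comm, ← orbitMap_mul E hH, map_sum, map_smul, hl,
        map_mul, smul_eq_mul]
      exact Finset.sum_congr rfl fun i _ => Finset.sum_congr rfl fun j _ => by ring)

/-- The action of `H` on a `p`-th root commutes with a Galois automorphism of order `p`, up to a
root of unity. -/
theorem map_smul_pow_eq_of_pow_prime_eq_one {p : ℕ} [Fact p.Prime] (hH : IsHopfGalois K H L)
    (hB : Module.Basis (Fin p) K H) {α : L} (b : Module.Basis (Fin p) K L)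
    (hb : ∀ k, b k = α ^ (k : ℕ)) {σ : E ≃ₐ[K] E} (hσp : σ ^ p = 1) {ζ : E}
    (hζ : IsPrimitiveRoot ζ p) (hσζ : σ ζ = ζ) (hα : α ≠ 0)
    (hσα : σ (algebraMap L E α) = ζ * algebraMap L E α) (h : H) (k : Fin p) :
    σ (algebraMap L E (h • α ^ (k : ℕ))) = ζ ^ (k : ℕ) * algebraMap L E (h • α ^ (k : ℕ)) := by
  set P := algebraMap L E α with hP
  have hP0 : P ≠ 0 := by simpa [hP] using hα
  set T : Matrix (Fin p) (Fin p) E := Matrix.vandermonde fun j => ζ ^ (j : ℕ) * P with hT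
  have hTu : IsUnit T := by
    rw [Matrix.isUnit_iff_isUnit_det, isUnit_iff_ne_zero, hT, Matrix.det_vandermonde_ne_zero_iff]
    intro i j hij
    exact Fin.ext (hζ.pow_inj i.2 j.2 (mul_right_cancel₀ hP0 hij))
  set N := actionMatrix E hB b with hN
  have hNu : IsUnit N := isUnit_actionMatrix E hH hB b
  have hNdet : IsUnit N.det := (Matrix.isUnit_iff_isUnit_det N).1 hNu
  -- Row `j` holds the coordinates in `E ⊗ H` of the element acting on `L` as `τ j`: `T` lists the
  -- values of the `τ j` on the powers of `α`, and `N` those of the basis of `H`.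
  set g := T * N⁻¹ with hg
  have hgN : g * N = T := Matrix.nonsing_inv_mul_cancel_right _ _ hNdet
  have hgu : IsUnit g := hTu.mul (Matrix.isUnit_nonsing_inv_iff.2 hNu)
  let τ : Fin p → L →ₐ[K] E := fun j =>
    ((σ ^ (j : ℕ) : E ≃ₐ[K] E) : E →ₐ[K] E).comp (IsScalarTower.toAlgHom K L E)
  have hσpow : ∀ j : ℕ, (σ ^ j) P = ζ ^ j * P := by
    intro j
    induction j with
    | zero => simp
    | succ j ih =>
      rw [pow_succ', AlgEquiv.mul_apply, ih, map_mul, map_pow, hσζ, hσα, pow_succ]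
      ring
  have hτ : ∀ j k : Fin p, τ j (α ^ (k : ℕ)) = T j k := by
    intro j k
    rw [map_pow, hT, Matrix.vandermonde_apply, ← hσpow]
    rfl
  have hgτ : ∀ j y, ∑ a, g j a * algebraMap L E (hB a • y) = τ j y := by
    intro j y
    let φ : L →ₗ[K] E := ∑ a, LinearMap.mulLeft K (g j a) ∘ₗ
      (IsScalarTower.toAlgHom K L E).toLinearMap ∘ₗ actionMap K H L (hB a)
    have hφ : ∀ y, φ y = ∑ a, g j a * algebraMap L E (hB a • y) := fun y => by
      simp only [φ, LinearMap.sum_apply]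
      rfl
    have : φ = (τ j).toLinearMap := by
      refine b.ext fun k => ?_
      rw [hφ, AlgHom.toLinearMap_apply]
      conv_rhs => rw [hb, hτ, ← hgN, Matrix.mul_apply]
      rfl
    rw [← hφ, this]
    rfl
  have hfix : ∀ j a, σ (g j a) = g j a := by
    intro j a
    let D := WithConv (H →ₗ[K] K)
    have : Module.Finite K H := hH.finite
    have hDfin : Module.Finite K D := Module.Finite.equiv (WithConv.linearEquiv K (H →ₗ[K] K)).symm
    have hDrank : Module.finrank K D = p := by
      rw [(WithConv.linearEquiv K (H →ₗ[K] K)).finrank_eq, Module.finrank_linearMap_self,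
        Module.finrank_eq_card_basis hB, Fintype.card_fin]
    have : IsScalarTower K E (WithConv (H →ₗ[K] E)) :=
      ⟨fun c e f => ofConv_injective (LinearMap.ext fun h => smul_assoc c e (f h))⟩
    let χ : D →ₐ[K] E :=
      ((characterOf hH hB b (g j) (τ j) (hgτ j)).restrictScalars K).comp (dualBaseChange K H E)
    let f : (D →ₐ[K] E) → (D →ₐ[K] E) := fun x => (σ : E →ₐ[K] E).comp x
    have hf : ∀ (m : ℕ) x d, (f^[m] x) d = (σ ^ m) (x d) := by
      intro m
      induction m with
      | zero => intro x d; rfl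
      | succ m ih =>
        intro x d
        rw [Function.iterate_succ_apply', pow_succ', AlgEquiv.mul_apply, ← ih]
        rfl
    -- The dual of `H` has dimension `p`, hence at most `p` characters into `E`. Composition with
    -- `σ` has order dividing `p` and fixes evaluation at `1`, so it fixes `χ`, whose values on dual
    -- basis vectors are the entries of `g`.
    have hχ := isFixedPt_of_card_le (f := f) (p := p)
      ((card_algHom_le_finrank K D E).trans hDrank.le)
      (fun x => AlgHom.ext fun d => by rw [hf, hσp]; rfl)
      (e := (Algebra.ofId K E).comp (dualEvalOne K H))
      (AlgHom.ext fun d => σ.commutes _) χ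
    have h1 : χ (toConv (hB.coord a)) = g j a := by
      change ∑ a', g j a' * algebraMap K E (hB.coord a (hB a')) = g j a
      simp [Finsupp.single_apply]
    rw [← h1]
    exact DFunLike.congr_fun hχ _
  -- As `g` has entries fixed by `σ`, applying `σ` to `g j · α ^ k = τ j (α ^ k)` multiplies the
  -- right side by `ζ ^ k`. So `g` kills the vector of differences, and `g` is invertible.
  have hX : ∀ a, σ (algebraMap L E (hB a • α ^ (k : ℕ))) -
      ζ ^ (k : ℕ) * algebraMap L E (hB a • α ^ (k : ℕ)) = 0 := by
    refine congrFun (?_ : _ = (0 : Fin p → E))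
    refine Matrix.mulVec_injective_iff_isUnit.2 hgu ?_
    rw [Matrix.mulVec_zero]
    funext j
    have h1 := hgτ j (α ^ (k : ℕ))
    have h2 := congrArg σ h1
    rw [hτ, hT, Matrix.vandermonde_apply, map_pow, map_mul, map_pow, hσζ, hσα, map_sum] at h2
    rw [hτ, hT, Matrix.vandermonde_apply] at h1
    simp only [map_mul, hfix] at h2
    simp only [Matrix.mulVec, dotProduct, mul_sub, Finset.sum_sub_distrib, h2, Pi.zero_apply]
    simp only [mul_left_comm (g j _), ← Finset.mul_sum, h1]
    ring
  have hrepr := hB.sum_repr h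
  rw [← hrepr]
  simp only [Finset.sum_smul, map_sum, Finset.mul_sum]
  refine Finset.sum_congr rfl fun a _ => ?_
  rw [smul_assoc, Algebra.smul_def, map_mul, map_mul, ← IsScalarTower.algebraMap_apply,
    AlgEquiv.commutes, sub_eq_zero.1 (hX a)]
  ring

end HopfGaloisAction

/-! ### The integral basis of powers of `α` -/

section GeneratingRoot

variable {p : ℕ} [Fact p.Prime] {K L : Type*} [Field K] [Algebra ℚ_[p] K]
  [FiniteDimensional ℚ_[p] K] [Field L] [Algebra ℚ_[p] L] [Algebra K L] [IsScalarTower ℚ_[p] K L]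
  [FiniteDimensional ℚ_[p] L]

/-- The valuations of `L` and `K` in terms of a `p`-th root of a uniformizer of `K`. -/
theorem IsGeneratingRoot.padicVal_spec {α : L} (hα : IsGeneratingRoot p K α) :
    0 < padicVal p L α ∧ padicVal p L α < 1 ∧
      ∀ c : K, c ≠ 0 → ∃ n : ℤ, padicVal p L (algebraMap K L c) = padicVal p L α ^ (p * n) := by
  have hp : p.Prime := Fact.out
  obtain ⟨⟨ϖ, hϖ, hαϖ⟩, -⟩ := hα
  obtain ⟨π, h0, h1, hπ⟩ := exists_uniformizer p (F := K)
  have hππ : π ≠ 0 := (Valuation.pos_iff _).1 h0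
  have hϖ1 : padicVal p K ϖ < 1 :=
    lt_of_le_of_ne ((padicVal_le_one_iff p).2 ϖ.2)
      fun h => hϖ.not_isUnit ((isUnit_ringOfIntegers_iff p).2 h)
  have hle := padicVal_le_of_lt_one h0 h1 hπ hϖ1
  have hval : padicVal p K ϖ = padicVal p K π := by
    have hq : padicVal p K (ϖ / π) ≤ 1 := by
      rw [map_div₀]; exact div_le_one_of_le₀ hle zero_le
    have hdec : ϖ = (⟨π, (padicVal_le_one_iff p).1 h1.le⟩ : ringOfIntegers p K) *
        ⟨ϖ / π, (padicVal_le_one_iff p).1 hq⟩ := Subtype.ext (by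
          change (ϖ : K) = π * (ϖ / π)
          field_simp)
    rcases hϖ.isUnit_or_isUnit hdec with h | h
    · exact absurd ((isUnit_ringOfIntegers_iff p).1 h) h1.ne
    · have h2 := (isUnit_ringOfIntegers_iff p).1 h
      simp only [map_div₀] at h2
      exact (div_eq_one_iff_eq h0.ne').1 h2
  have hαp : padicVal p L α ^ p = padicVal p K π := by
    rw [← map_pow, hαϖ, padicVal_algebraMap, hval]
  refine ⟨?_, ?_, fun c hc => ?_⟩
  · rw [← pow_pos_iff hp.ne_zero, hαp]; exact h0
  · rw [← pow_lt_one_iff_of_nonneg zero_le hp.ne_zero, hαp]; exact h1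
  · obtain ⟨n, hn⟩ := hπ c hc
    exact ⟨n, by rw [padicVal_algebraMap, hn, ← hαp, zpow_mul, zpow_natCast]⟩

/-- The basis of `L/K` given by the powers of a `p`-th root of a uniformizer. -/
def IsGeneratingRoot.basis {α : L} (hα : IsGeneratingRoot p K α) (hdeg : Module.finrank K L = p) :
    Module.Basis (Fin p) K L :=
  have : Nonempty (Fin p) := ⟨⟨0, (Fact.out : p.Prime).pos⟩⟩
  basisOfLinearIndependentOfCardEqFinrank
    (linearIndependent_pow (padicVal p L) hα.padicVal_spec.1 hα.padicVal_spec.2.1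
      hα.padicVal_spec.2.2) (by simp [hdeg])

theorem IsGeneratingRoot.basis_apply {α : L} (hα : IsGeneratingRoot p K α)
    (hdeg : Module.finrank K L = p) (k : Fin p) : hα.basis hdeg k = α ^ (k : ℕ) := by
  simp [IsGeneratingRoot.basis]

theorem IsGeneratingRoot.ne_zero {α : L} (hα : IsGeneratingRoot p K α) : α ≠ 0 :=
  (Valuation.pos_iff _).1 hα.padicVal_spec.1

/-- With `v c = v α ^ (p n)`, the inequality `p n + k ≥ 0` together with `k < p` forces `n ≥ 0`. -/
theorem IsGeneratingRoot.mem_of_padicVal_smul_pow_le_one {α : L} (hα : IsGeneratingRoot p K α)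
    {c : K} {k : ℕ} (hk : k < p) (h : padicVal p L (c • α ^ k) ≤ 1) :
    c ∈ ringOfIntegers p K := by
  by_cases hc : c = 0
  · rw [hc]; exact zero_mem _
  obtain ⟨h0, h1, hK⟩ := hα.padicVal_spec
  obtain ⟨n, hn⟩ := hK c hc
  rw [Algebra.smul_def, map_mul, map_pow, hn, ← zpow_natCast, ← zpow_add₀ h0.ne',
    zpow_le_one_iff_right_of_lt_one₀ h0 h1] at h
  rw [← padicVal_le_one_iff, ← padicVal_algebraMap (E := L), hn,
    zpow_le_one_iff_right_of_lt_one₀ h0 h1]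
  have hp : (0 : ℤ) < p := by exact_mod_cast (Fact.out : p.Prime).pos
  have : 0 ≤ n := by
    by_contra! hn0
    have : (p : ℤ) * n ≤ p * (-1) := mul_le_mul_of_nonneg_left (by omega) hp.le
    omega
  positivity

/-- The powers of a `p`-th root of a uniformizer form an integral basis. -/
theorem IsGeneratingRoot.exists_eq_sum {α : L} (hα : IsGeneratingRoot p K α)
    (hdeg : Module.finrank K L = p) {x : L} (hx : x ∈ ringOfIntegers p L) :
    ∃ c : Fin p → ringOfIntegers p K, x = ∑ k, (c k : K) • α ^ (k : ℕ) := by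
  obtain ⟨h0, h1, hK⟩ := hα.padicVal_spec
  obtain ⟨c, hc⟩ := exists_eq_powSum (padicVal p L) h0 h1 hK
    (Fact.out : p.Prime).pos hdeg x
  refine ⟨fun k => ⟨c k, hα.mem_of_padicVal_smul_pow_le_one k.2 ?_⟩, hc⟩
  refine (map_smul_pow_le _ h0 h1 hK c k).trans ?_
  rw [← hc]
  exact (padicVal_le_one_iff p).2 hx

theorem IsGeneratingRoot.mem_ringOfIntegers {α : L} (hα : IsGeneratingRoot p K α) :
    α ∈ ringOfIntegers p L :=
  (padicVal_le_one_iff p).1 hα.padicVal_spec.2.1.le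

end GeneratingRoot

/-! ### The powers of `α` are eigenvectors of `H` -/

section Eigenvectors

theorem finrank_eq_of_isHopfGalois {K H L : Type*} [Field K] [Field L] [Algebra K L] [Ring H]
    [HopfAlgebra K H] [Module H L] [IsScalarTower K H L] [FiniteDimensional K L]
    (hH : IsHopfGalois K H L) : Module.finrank K H = Module.finrank K L := by
  have h := (LinearEquiv.ofBijective _ hH.bijective).finrank_eq
  rw [Module.finrank_tensorProduct, Module.finrank_linearMap] at h
  exact Nat.eq_of_mul_eq_mul_left Module.finrank_pos h

/-- If `σ ζ = ζ ^ i`, then `ζ = σ ^ p ζ = ζ ^ (i ^ p) = ζ ^ i` by Fermat. -/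
theorem fixed_of_pow_prime_eq_one {p : ℕ} [Fact p.Prime] {K E : Type*} [Field K] [Field E]
    [Algebra K E] {σ : E ≃ₐ[K] E} (hσp : σ ^ p = 1) {ζ : E} (hζ : IsPrimitiveRoot ζ p) :
    σ ζ = ζ := by
  have hp : p.Prime := Fact.out
  have : NeZero p := ⟨hp.ne_zero⟩
  obtain ⟨i, -, hi⟩ := hζ.eq_pow_of_pow_eq_one (ξ := σ ζ) (by rw [← map_pow, hζ.pow_eq_one, map_one])
  have hiter : ∀ m : ℕ, (σ ^ m) ζ = ζ ^ (i ^ m) := by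
    intro m
    induction m with
    | zero => simp
    | succ m ih => rw [pow_succ', AlgEquiv.mul_apply, ih, map_pow, ← hi, ← pow_mul, pow_succ']
  have h1 := hiter p
  rw [hσp, AlgEquiv.one_apply] at h1
  have h2 : i ^ p ≡ i [MOD p] := by
    rw [← ZMod.natCast_eq_natCast_iff]
    simp
  rw [pow_eq_pow_mod (i ^ p) hζ.pow_eq_one, h2, ← pow_eq_pow_mod i hζ.pow_eq_one, hi] at h1
  exact h1.symm

variable {p : ℕ} [Fact p.Prime] {K L H : Type*} (E : Type*) [Field K] [Algebra ℚ_[p] K]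
  [FiniteDimensional ℚ_[p] K] [Field L] [Algebra ℚ_[p] L] [Algebra K L] [IsScalarTower ℚ_[p] K L]
  [FiniteDimensional ℚ_[p] L] [Field E] [Algebra K E] [Algebra L E] [IsScalarTower K L E]
  [IsNormalClosure K L E] [Ring H] [HopfAlgebra K H] [Module H L] [IsScalarTower K H L]

include E in
/-- The powers of a `p`-th root of a uniformizer are eigenvectors for the action of `H`. -/
theorem exists_smul_pow_eq_smul (hH : IsHopfGalois K H L) (hdeg : Module.finrank K L = p) {α : L}
    (hα : IsGeneratingRoot p K α) (h : H) (k : Fin p) :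
    ∃ c : K, h • α ^ (k : ℕ) = c • α ^ (k : ℕ) := by
  have hp : p.Prime := Fact.out
  have : CharZero K := charZero_of_injective_algebraMap (algebraMap ℚ_[p] K).injective
  have : FiniteDimensional K L := Module.finite_of_finrank_pos (hdeg ▸ hp.pos)
  have := hH.finite
  obtain ⟨σ, hσ⟩ := exists_gal_orderOf_eq K L E hp hdeg
  have hσp : σ ^ p = 1 := hσ ▸ pow_orderOf_eq_one σ
  have hσ1 : σ ≠ 1 := by
    rintro rfl
    rw [orderOf_one] at hσ
    exact hp.one_lt.ne hσ
  obtain ⟨y, hy⟩ := exists_ne_of_pow_prime_eq_one K L hp hdeg hσ1 hσp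
  -- A fixed `α` would lie in `K`, where all values are powers of `v α ^ p`.
  have hσα : σ (algebraMap L E α) ≠ algebraMap L E α := by
    intro hfix
    obtain ⟨c, hc⟩ := mem_range_of_fixed K hp hdeg hy hfix
    obtain ⟨h0, h1, hK⟩ := hα.padicVal_spec
    obtain ⟨n, hn⟩ := hK c (by rintro rfl; exact hα.ne_zero (by rw [← hc, map_zero]))
    rw [hc] at hn
    have h2 := zpow_right_injective₀ h0 h1.ne ((zpow_one _).trans hn)
    have h3 : (p : ℤ) ∣ 1 := ⟨n, h2⟩
    exact hp.one_lt.ne' (by exact_mod_cast Int.eq_one_of_dvd_one (by omega) h3)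
  set P := algebraMap L E α with hP
  have hP0 : P ≠ 0 := by simpa [hP] using hα.ne_zero
  set ζ := σ P / P with hζdef
  have hσP : σ P = ζ * P := by rw [hζdef]; field_simp
  have hζ : IsPrimitiveRoot ζ p := by
    rw [IsPrimitiveRoot.iff_orderOf]
    refine orderOf_eq_prime ?_ fun h1 => hσα (by rw [hσP, h1, one_mul])
    obtain ⟨⟨ϖ, -, hϖ⟩, -⟩ := hα
    rw [hζdef, div_pow, ← map_pow, hP, ← map_pow, hϖ, ← IsScalarTower.algebraMap_apply,
      AlgEquiv.commutes, div_self]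
    rw [IsScalarTower.algebraMap_apply K L E, ← hϖ, map_pow]
    exact pow_ne_zero _ hP0
  have hB : Module.Basis (Fin p) K H :=
    Module.finBasisOfFinrankEq K H ((finrank_eq_of_isHopfGalois hH).trans hdeg)
  have key := map_smul_pow_eq_of_pow_prime_eq_one hH hB (hα.basis hdeg) (hα.basis_apply hdeg) hσp hζ
    (fixed_of_pow_prime_eq_one hσp hζ) hα.ne_zero hσP h k
  have hαk : α ^ (k : ℕ) ≠ 0 := pow_ne_zero _ hα.ne_zero
  obtain ⟨c, hc⟩ := mem_range_of_fixed K hp hdeg hy (x := h • α ^ (k : ℕ) / α ^ (k : ℕ)) (by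
    rw [map_div₀, map_div₀, key, map_pow (algebraMap L E), ← hP, map_pow, hσP, mul_pow]
    have hζ0 : ζ ≠ 0 := hζ.ne_zero hp.ne_zero
    field_simp)
  refine ⟨c, ?_⟩
  rw [Algebra.smul_def, hc]
  field_simp

end Eigenvectors

/-! ### Diagonalization of `H`, the associated order, and freeness -/

section DiagonalAction

variable {p : ℕ} [Fact p.Prime] {K L H : Type*} [Field K] [Algebra ℚ_[p] K]
  [FiniteDimensional ℚ_[p] K] [Field L] [Algebra ℚ_[p] L] [Algebra K L] [IsScalarTower ℚ_[p] K L]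
  [FiniteDimensional ℚ_[p] L] [Ring H] [HopfAlgebra K H] [Module H L] [IsScalarTower K H L]

/-- `H` is isomorphic to the algebra of diagonal matrices with respect to the basis of powers of
`α`. -/
theorem exists_diagonalization (E : Type*) [Field E] [Algebra K E] [Algebra L E]
    [IsScalarTower K L E] [IsNormalClosure K L E] (hH : IsHopfGalois K H L)
    (hdeg : Module.finrank K L = p) {α : L} (hα : IsGeneratingRoot p K α) :
    ∃ Λ : H ≃ₐ[K] (Fin p → K), ∀ (h : H) (k : Fin p), h • α ^ (k : ℕ) = Λ h k • α ^ (k : ℕ) := by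
  have hp : p.Prime := Fact.out
  have : FiniteDimensional K L := Module.finite_of_finrank_pos (hdeg ▸ hp.pos)
  have := hH.finite
  choose l hl using fun h k => exists_smul_pow_eq_smul E hH hdeg hα h k
  have hinj : ∀ (k : Fin p) {c d : K}, c • α ^ (k : ℕ) = d • α ^ (k : ℕ) → c = d :=
    fun k c d h => smul_left_injective K (pow_ne_zero _ hα.ne_zero) h
  let Λ : H →ₐ[K] (Fin p → K) := AlgHom.ofLinearMap
    { toFun := l
      map_add' := fun x y => funext fun k => hinj k (by
        rw [← hl, add_smul, hl, hl, Pi.add_apply, add_smul])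
      map_smul' := fun c x => funext fun k => hinj k (by
        rw [← hl, smul_assoc, hl, RingHom.id_apply, Pi.smul_apply, smul_assoc]) }
    (funext fun k => hinj k (by
      change l 1 k • _ = (1 : K) • _
      rw [← hl, one_smul, one_smul]))
    (fun x y => funext fun k => hinj k (by
      change l (x * y) k • _ = (l x k * l y k) • _
      rw [← hl, mul_smul, hl y, mul_comm, mul_smul, ← hl x]
      exact (actionMap K H L x).map_smul (l y k) _))
  -- An `h` that kills all powers of `α` satisfies `j (1 ⊗ h) = 0`; surjectivity then follows from
  -- equal dimensions.
  have hΛ : Function.Injective Λ := by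
    rw [injective_iff_map_eq_zero]
    intro h hh
    have h1 : jMap K H L (1 ⊗ₜ h) = 0 := by
      refine (hα.basis hdeg).ext fun k => ?_
      rw [jMap_tmul_apply, hα.basis_apply, one_mul, hl, LinearMap.zero_apply]
      have : l h k = 0 := congrFun hh k
      rw [this, zero_smul]
    have h2 := hH.bijective.1 (h1.trans (map_zero _).symm)
    exact Algebra.TensorProduct.includeRight_injective (R := K) (A := L) (B := H)
      (algebraMap K L).injective (h2.trans (map_zero _).symm)
  have hbij : Function.Bijective Λ := by
    refine ⟨hΛ, ?_⟩
    have h1 : Module.finrank K H = Module.finrank K (Fin p → K) := by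
      rw [finrank_eq_of_isHopfGalois hH, hdeg, Module.finrank_fin_fun]
    exact (LinearMap.injective_iff_surjective_of_finrank_eq_finrank
      (f := Λ.toLinearMap) h1).1 hΛ
  exact ⟨AlgEquiv.ofBijective Λ hbij, hl⟩

variable {α : L} (hα : IsGeneratingRoot p K α) (hdeg : Module.finrank K L = p)
  {Λ : H ≃ₐ[K] (Fin p → K)} (hΛ : ∀ (h : H) (k : Fin p), h • α ^ (k : ℕ) = Λ h k • α ^ (k : ℕ))
include hα hdeg hΛ

omit [Fact p.Prime] [Algebra ℚ_[p] K] [FiniteDimensional ℚ_[p] K] [FiniteDimensional ℚ_[p] L]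
  [Algebra ℚ_[p] L] [IsScalarTower ℚ_[p] K L] hα hdeg in
theorem smul_powSum (h : H) (c : Fin p → K) :
    h • (∑ k, c k • α ^ (k : ℕ)) = ∑ k, (c k * Λ h k) • α ^ (k : ℕ) := by
  rw [Finset.smul_sum]
  refine Finset.sum_congr rfl fun k _ => ?_
  rw [mul_smul, ← hΛ]
  exact (actionMap K H L h).map_smul (c k) _

theorem mem_associatedOrder_iff {h : H} :
    h ∈ associatedOrder p K H L ↔ ∀ k, Λ h k ∈ ringOfIntegers p K := by
  constructor
  · intro hh k
    refine hα.mem_of_padicVal_smul_pow_le_one k.2 ?_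
    rw [← hΛ, padicVal_le_one_iff]
    exact hh _ (pow_mem hα.mem_ringOfIntegers _)
  · intro hh x hx
    obtain ⟨c, rfl⟩ := hα.exists_eq_sum hdeg hx
    rw [smul_powSum hΛ]
    exact sum_mem fun k _ => smul_mem_ringOfIntegers p ⟨_, mul_mem (c k).2 (hh k)⟩
      (pow_mem hα.mem_ringOfIntegers _)

/-- The associated order is the algebra of integral diagonal matrices. -/
def associatedOrderEquiv : associatedOrder p K H L ≃ₗ[ringOfIntegers p K]
    (Fin p → ringOfIntegers p K) where
  toFun h k := ⟨Λ h k, (mem_associatedOrder_iff hα hdeg hΛ).1 h.2 k⟩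
  invFun c := ⟨Λ.symm fun k => c k, (mem_associatedOrder_iff hα hdeg hΛ).2 fun k => by
    rw [AlgEquiv.apply_symm_apply]; exact (c k).2⟩
  left_inv h := Subtype.ext (Λ.symm_apply_apply h)
  right_inv c := funext fun k => Subtype.ext (congrFun (Λ.apply_symm_apply fun k => (c k : K)) k)
  map_add' x y := funext fun k => Subtype.ext (by
    change Λ (x + y) k = _
    rw [map_add]; rfl)
  map_smul' c x := funext fun k => Subtype.ext (by
    change Λ ((c : K) • (x : H)) k = _
    rw [map_smul]; rfl)

/-- The basis of the associated order consisting of the projections onto the powers of `α`. -/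
def associatedOrderBasis :
    Module.Basis (Fin p) (ringOfIntegers p K) (associatedOrder p K H L) :=
  .ofEquivFun (associatedOrderEquiv hα hdeg hΛ)

theorem apply_associatedOrderBasis (i : Fin p) :
    Λ (associatedOrderBasis hα hdeg hΛ i) = Pi.single i 1 := by
  have h : (associatedOrderBasis hα hdeg hΛ i : H) =
      Λ.symm fun k => ((Pi.single i 1 : Fin p → ringOfIntegers p K) k : K) := by
    rw [associatedOrderBasis, Module.Basis.coe_ofEquivFun]
    rfl
  rw [h, AlgEquiv.apply_symm_apply]
  funext k
  by_cases hk : k = i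
  · subst hk; simp
  · simp [hk]

theorem associatedOrderBasis_mul (i j : Fin p) :
    associatedOrderBasis hα hdeg hΛ i * associatedOrderBasis hα hdeg hΛ j =
      if i = j then associatedOrderBasis hα hdeg hΛ i else 0 := by
  refine Subtype.ext (Λ.injective ?_)
  rw [MulMemClass.coe_mul, map_mul, apply_associatedOrderBasis, apply_associatedOrderBasis]
  split_ifs with h
  · rw [apply_associatedOrderBasis, h, ← Pi.single_mul, one_mul]
  · rw [ZeroMemClass.coe_zero, map_zero]
    funext k
    by_cases hk : k = i
    · subst hk; simp [h]
    · simp [hk]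

theorem associatedOrderBasis_smul (i j : Fin p) :
    (associatedOrderBasis hα hdeg hΛ i : H) • α ^ (j : ℕ) =
      if i = j then α ^ (j : ℕ) else 0 := by
  rw [hΛ, apply_associatedOrderBasis]
  split_ifs with h
  · simp [h]
  · simp [Ne.symm h]

/-- Elements of any order are integral over `𝓞_K`, hence so are their diagonal entries, and `𝓞_K` is
integrally closed in `K`. -/
theorem isTheMaximalOrder_associatedOrder :
    IsTheMaximalOrder p K (associatedOrder p K H L) := by
  refine ⟨⟨?_, ?_⟩, ?_⟩
  · have : Module.Finite (ringOfIntegers p K) (associatedOrder p K H L) :=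
      Module.Finite.of_basis (associatedOrderBasis hα hdeg hΛ)
    exact Module.Finite.iff_fg.1 this
  · rw [eq_top_iff]
    intro h _
    have h1 : h = ∑ k, Λ h k • (associatedOrderBasis hα hdeg hΛ k : H) := by
      apply Λ.injective
      simp only [map_sum, map_smul, apply_associatedOrderBasis]
      funext j
      simp [Finset.sum_apply, Pi.single_apply]
    rw [h1]
    exact sum_mem fun k _ => Submodule.smul_mem _ _
      (Submodule.subset_span (associatedOrderBasis hα hdeg hΛ k).2)
  · rintro Γ ⟨hΓ, -⟩ h hh
    rw [mem_associatedOrder_iff hα hdeg hΛ]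
    intro k
    have h1 : IsIntegral (ringOfIntegers p K) h := IsIntegral.of_mem_of_fg Γ hΓ h hh
    have h2 : IsIntegral (ringOfIntegers p K) (Λ h k) :=
      h1.map (((Pi.evalAlgHom K (fun _ : Fin p => K) k).comp
        (Λ : H →ₐ[K] (Fin p → K))).restrictScalars (ringOfIntegers p K))
    have h3 : (padicVal p K).Integers (ringOfIntegers p K) :=
      { hom_inj := Subtype.val_injective
        map_le_one := fun x => (padicVal_le_one_iff p).2 x.2
        exists_of_le_one := fun {r} hr => ⟨⟨r, (padicVal_le_one_iff p).1 hr⟩, rfl⟩ }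
    exact (padicVal_le_one_iff p).1 (h3.mem_of_integral h2)

/-- The generator `∑ α ^ k` has all coordinates `1`, so acting on it by `h` reads off the diagonal
entries of `h` as coordinates. -/
theorem free_ringOfIntegers : Module.Free (associatedOrder p K H L) (ringOfIntegers p L) := by
  let θ : ringOfIntegers p L :=
    ⟨∑ k : Fin p, α ^ (k : ℕ), sum_mem fun k _ => pow_mem hα.mem_ringOfIntegers _⟩
  have hθ : ∀ h : H, h • (θ : L) = ∑ k, Λ h k • α ^ (k : ℕ) := by
    intro h
    have := smul_powSum hΛ h fun _ => 1
    simpa using this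
  have hbij : Function.Bijective (LinearMap.toSpanSingleton (associatedOrder p K H L) _ θ) := by
    constructor
    · rw [injective_iff_map_eq_zero]
      intro h hh
      have h1 : (h : H) • (θ : L) = 0 := congrArg Subtype.val hh
      rw [hθ] at h1
      have h2 := Fintype.linearIndependent_iff.1 (hα.basis hdeg).linearIndependent (Λ h)
        (by simpa only [hα.basis_apply] using h1)
      refine Subtype.ext (Λ.injective ?_)
      rw [ZeroMemClass.coe_zero, map_zero]
      exact funext h2
    · intro x
      obtain ⟨c, hc⟩ := hα.exists_eq_sum hdeg x.2
      refine ⟨(associatedOrderEquiv hα hdeg hΛ).symm c, Subtype.ext ?_⟩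
      change (Λ.symm fun k => (c k : K)) • (θ : L) = x
      rw [hθ, AlgEquiv.apply_symm_apply, hc]
  exact Module.Free.of_equiv (LinearEquiv.ofBijective _ hbij)

end DiagonalAction

end HopfGaloisPadic

end

open HopfGaloisPadic in
theorem mainTheorem3 (p : ℕ) [Fact p.Prime] (hp : p ≠ 2)
    (K L E H : Type*)
    -- `L/K` is an extension of degree `p` of `p`-adic fields
    [Field K] [Algebra ℚ_[p] K] [FiniteDimensional ℚ_[p] K]
    [Field L] [Algebra ℚ_[p] L] [Algebra K L] [IsScalarTower ℚ_[p] K L]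
    (hdeg : Module.finrank K L = p)
    -- `E` is the normal closure of `L/K`
    [Field E] [Algebra ℚ_[p] E] [Algebra K E] [Algebra L E]
    [IsScalarTower ℚ_[p] K E] [IsScalarTower ℚ_[p] L E] [IsScalarTower K L E]
    [IsNormalClosure K L E]
    -- `H` is a Hopf-Galois structure on `L/K`
    [Ring H] [HopfAlgebra K H] [Module H L] [IsScalarTower K H L]
    (hH : IsHopfGalois K H L)
    -- the maximally ramified case, in either of its two descriptions
    (hram : IsMaximallyRamified p K L E ∨ ∃ α : L, IsGeneratingRoot p K α) :
    (∃ α : L, IsGeneratingRoot p K α) ∧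
    (∀ α : L, IsGeneratingRoot p K α →
      ∃ v : Module.Basis (Fin p) (ringOfIntegers p K) (associatedOrder p K H L),
        (∀ i j, v i * v j = if i = j then v i else 0) ∧
        (∀ i j : Fin p, (v i : H) • α ^ (j : ℕ) = if i = j then α ^ (j : ℕ) else 0)) ∧
    IsTheMaximalOrder p K (associatedOrder p K H L) ∧
    Module.Free (associatedOrder p K H L) (ringOfIntegers p L) := by
  have : FiniteDimensional K L :=
    Module.finite_of_finrank_pos (hdeg ▸ (Fact.out : p.Prime).pos)
  have : FiniteDimensional ℚ_[p] L := FiniteDimensional.trans ℚ_[p] K L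
  have hroot : ∃ α : L, IsGeneratingRoot p K α :=
    hram.elim (exists_isGeneratingRoot_of_isMaximallyRamified hdeg) id
  refine ⟨hroot, fun α hα => ?_, ?_⟩
  · obtain ⟨Λ, hΛ⟩ := exists_diagonalization E hH hdeg hα
    exact ⟨associatedOrderBasis hα hdeg hΛ, associatedOrderBasis_mul hα hdeg hΛ,
      associatedOrderBasis_smul hα hdeg hΛ⟩
  · obtain ⟨α, hα⟩ := hroot
    obtain ⟨Λ, hΛ⟩ := exists_diagonalization E hH hdeg hα
    exact ⟨isTheMaximalOrder_associatedOrder hα hdeg hΛ, free_ringOfIntegers hα hdeg hΛ⟩
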